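/- **Model.** A base station serves finitely many users in slots $k=0,1,2,\dots$ of duration $T_s>0$: real-time (RT) users $i\in\mathcal N_R$ (possibly none) and non-real-time (NRT) users $i\in\mathcal N_{NR}\neq\emptyset$; $\mathcal N=\mathcal N_R\cup\mathcal N_{NR}$. Packets have $L>0$ bits. The packet arrivals $a_i(k)\in\{0,1\}$ are Bernoulli with rate $\lambda_i\in[0,1]$, and the channel gains $\gamma_i(k)\in[0,\gamma_{\max}]$, $\gamma_{\max}<\infty$, have an arbitrary distribution that may depend on $i$; all of them are independent over users and slots, arrivals and gains are independent of each other, and for each user they are identically distributed over the slots. At the beginning of slot $k$ an algorithm knows the past, $a(k)$ and $\gamma(k)$, and chooses (possibly with randomization, and without knowledge of the future) admissions $r_i(k)\in\{0,1\}$ ($i\in\mathcal N_{NR}$), durations $\mu_i(k)$ and powers $P_i(k)$ ($i\in\mathcal N$). With $R_i(k)=\log(1+P_i(k)\gamma_i(k))$, the NRT queues are $$Q_i(k+1)=\big(Q_i(k)+L r_i(k)-\mu_i(k)R_i(k)\big)^+,\qquad Q_i(0)\ge 0 \text{ given constants},$$ and $D_i(k)=\min\{\mu_i(k)R_i(k),\,Q_i(k)+Lr_i(k)\}$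 is the number of bits transmitted to NRT user $i$ in slot $k$ (it equals $\mu_i(k)R_i(k)$ if the user has enough data for the time assigned to it). **Problem.** Maximize the NRT sum throughput $\liminf_{K\to\infty}\frac1K\sum_{k<K}\sum_{i\in\mathcal N_{NR}}\mathbb E[D_i(k)]/L$ (packets per slot) subject to: $r_i(k)\le a_i(k)$ and $\limsup_k\mathbb E[Q_i(k)]<\infty$ for $i\in\mathcal N_{NR}$; in each slot, an RT user $i$ either has $\mu_i(k)=0$, or has received a packet ($a_i(k)=1$) and $\mu_i(k)R_i(k)=L$; $\liminf_K\frac1K\sum_{k<K}\mathbb E[\mu_i(k)R_i(k)]/L\ge\lambda_iq_i$ for $i\in\mathcal N_R$, where $q_i\in[0,1]$; $\limsup_K\frac1{KT_s}\sum_{k<K}\sum_{i\in\mathcal N}\mathbb E[P_i(k)\mu_i(k)]\le P_{avg}$; $0\le P_i(k)\le P_{\max}$, $0\le\mu_i(k)\le T_s$ and $\sum_{i\in\mathcal N}\mu_i(k)=T_s$. Here $P_{\max},P_{avg}>0$. The problem is feasible if some algorithm meets all constraints, and its optimum is the supremum of the throughput over these algorithms. **Lambert-Strict algorithm with parameter $B>0$.**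 It keeps virtual queues $X(0)=0$, $Y_i(0)=0$, $$Y_i(k+1)=\big(Y_i(k)+a_i(k)q_i-\mathbf 1[\mu_i(k)\ne0]\big)^+\ (i\in\mathcal N_R),\quad X(k+1)=\Big(X(k)+\tfrac1{T_s}\sum_{i\in\mathcal N}P_i(k)\mu_i(k)-P_{avg}\Big)^+ .$$ In slot $k$ (index $k$ dropped): 1. For each NRT user let $P_i^{*}=\min\{(T_sQ_i/X-1/\gamma_i)^+,P_{\max}\}$ (with $P_i^*=0$ if $Q_i=0$ or $\gamma_i=0$, and otherwise $P_i^*=P_{\max}$ if $X=0$) and $\Psi_i=Q_i\log(1+P_i^*\gamma_i)-XP_i^*/T_s$. Choose $i^*\in\arg\max_i\Psi_i$; put $P_{i^*}=P_{i^*}^*$, and $P_i=\mu_i=0$ for the other NRT users. 2. Call an RT user available if $a_i=1$ and $\gamma_i>0$. Consider every set $S$ of available RT users, except those for which there are an available $i\notin S$ and a $j\in S$ with $Y_i>Y_j$ and $\gamma_i>\gamma_j$. For $S$, take (if there is one) a $\phi\ge0$ such that the choice $$P_i=\min\Big\{\frac1{\gamma_i}\Big[\frac{\tilde\phi\gamma_i-1}{W_0\big((\tilde\phi\gamma_i-1)e^{-1}\big)}-1\Big],P_{\max}\Big\},\quad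 \mu_i=\frac L{R_i}\quad(i\in S),\qquad \tilde\phi=\frac{(\Psi_{i^*}+\phi)T_s}{X},$$ $P_i=\mu_i=0$ for RT users $i\notin S$, $\mu_{i^*}=T_s-\sum_{i\in S}\mu_i$ satisfies $R_i>0$ for $i\in S$, $\mu_{i^*}\ge0$ and $\phi\mu_{i^*}=0$. ($W_0$ is the principal branch of the Lambert function, $z/W_0(z/e)$ is read as $e$ at $z=0$, and $P_i=P_{\max}$ if $X=0$.) Use a set $S$ with such a $\phi$, and the corresponding choice, for which $\sum_{i\in S}(Y_i-XP_i\mu_i/T_s)+\Psi_{i^*}\mu_{i^*}$ is largest. 3. For each NRT user put $r_i=a_i$ if $Q_i<B$ and $r_i=0$ otherwise. Ties are broken arbitrarily (possibly at random, without knowledge of the future). **Theorem.** There is a finite constant $C_2$, depending only on the sets of users and on $L,T_s,P_{\max},P_{avg},\gamma_{\max},(q_i)$, such that, whenever the problem is feasible, for every $B>0$ the Lambert-Strict algorithm satisfies all constraints of the problem, and $$(\text{NRT sum throughput of the algorithm})\ \ge\ (\text{optimum})-\frac{C_2}{L\,B}.$$ -/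

import Mathlib

open MeasureTheory ProbabilityTheory Filter

noncomputable section

namespace Scheduling

/-! ### The principal branch of the Lambert function -/

/-- The principal branch `W₀` of the Lambert function.  For `z ≥ -1/e` the set below is bounded
above and its supremum is the unique `w ≥ -1` with `w * exp w = z`. -/
def lambertW (z : ℝ) : ℝ := sSup {w : ℝ | w * Real.exp w ≤ z}

theorem mul_exp_lt_mul_exp {a b : ℝ} (ha : -1 ≤ a) (hab : a < b) :
    a * Real.exp a < b * Real.exp b := by
  have h1 : (b - a) + 1 < Real.exp (b - a) := Real.add_one_lt_exp (by linarith)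
  have h2 : Real.exp b = Real.exp (b - a) * Real.exp a := by
    rw [← Real.exp_add]; ring_nf
  have h3 : 0 < Real.exp a := Real.exp_pos a
  rw [h2, ← mul_assoc]
  refine mul_lt_mul_of_pos_right ?_ h3
  rcases le_or_gt 0 b with hb | hb
  · nlinarith
  · by_contra hcon
    push Not at hcon
    have he : 1 < Real.exp (b - a) := by linarith
    have h4 : Real.exp (b - a) * (1 - (b - a)) < 1 := by
      have h5 : 1 - (b - a) < Real.exp (-(b - a)) := by
        have := Real.add_one_lt_exp (neg_ne_zero.2 (sub_ne_zero.2 hab.ne')); linarith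
      calc Real.exp (b - a) * (1 - (b - a))
          < Real.exp (b - a) * Real.exp (-(b - a)) :=
            mul_lt_mul_of_pos_left h5 (Real.exp_pos _)
        _ = 1 := by rw [← Real.exp_add]; simp
    nlinarith [mul_nonneg (by linarith : (0 : ℝ) ≤ a + 1) (sub_nonneg.2 he.le)]

/-- `lambertW` inverts `w ↦ w * exp w` on `[-1, ∞)`. -/
theorem lambertW_mul_exp {w : ℝ} (hw : -1 ≤ w) : lambertW (w * Real.exp w) = w := by
  refine csSup_eq_of_forall_le_of_forall_lt_exists_gt ⟨w, le_refl (w * Real.exp w)⟩ ?_ ?_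
  · intro v hv
    by_contra h
    push Not at h
    exact absurd (mul_exp_lt_mul_exp hw h) (not_lt.2 hv)
  · intro v hv
    exact ⟨w, le_refl (w * Real.exp w), hv⟩

/-! ### The model -/

variable {RT NRT : Type*}

/-- The deterministic parameters of the cell. -/
structure Cell (RT : Type*) where
  /-- number of bits per packet -/
  L : ℝ
  /-- duration of a time slot -/
  Ts : ℝ
  /-- peak transmission power -/
  Pmax : ℝ
  /-- average power budget of the base station -/
  Pavg : ℝ
  /-- upper bound on the channel gains -/
  gmax : ℝ
  /-- required delivery ratios of the real-time users -/
  q : RT → ℝ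
  L_pos : 0 < L
  Ts_pos : 0 < Ts
  Pmax_pos : 0 < Pmax
  Pavg_pos : 0 < Pavg
  gmax_nonneg : 0 ≤ gmax
  q_mem : ∀ i, q i ∈ Set.Icc (0 : ℝ) 1

/-- The statistics of the arrivals and of the channels (users are `RT ⊕ NRT`), and the numbers of
bits initially stored in the buffers of the non-real-time users. -/
structure Scenario (c : Cell RT) (NRT : Type*) where
  /-- arrival rates, in packets per slot -/
  lam : RT ⊕ NRT → ℝ
  /-- distributions of the channel power gains -/
  gainLaw : RT ⊕ NRT → Measure ℝ
  /-- initial backlogs -/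
  Q₀ : NRT → ℝ
  lam_mem : ∀ i, lam i ∈ Set.Icc (0 : ℝ) 1
  gainLaw_prob : ∀ i, IsProbabilityMeasure (gainLaw i)
  gainLaw_supp : ∀ i, gainLaw i (Set.Icc 0 c.gmax) = 1
  Q₀_nonneg : ∀ i, 0 ≤ Q₀ i

/-- The Bernoulli distribution on `{0, 1} ⊆ ℝ` with success probability `p`. -/
def bernoulliLaw (p : ℝ) : Measure ℝ :=
  ENNReal.ofReal p • Measure.dirac 1 + ENNReal.ofReal (1 - p) • Measure.dirac 0

/-- The joint distribution of the pairs (arrival, gain) of all users in one slot: everything is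
independent. -/
def Scenario.slotLaw [Fintype RT] [Fintype NRT] {c : Cell RT} (s : Scenario c NRT) :
    Measure (RT ⊕ NRT → ℝ × ℝ) :=
  Measure.pi fun i => (bernoulliLaw (s.lam i)).prod (s.gainLaw i)

/-- Arrival and channel processes on a probability space, together with the information of the
base station.  The σ-algebra `hist k` is what is known before slot `k` (it may contain auxiliary
randomization); the arrivals and gains of slot `k` are independent of it, and they are known when
the decisions of slot `k` are taken, i.e. they are `hist (k + 1)`-measurable. -/
structure Network [Fintype RT] [Fintype NRT] {c : Cell RT} (s : Scenario c NRT)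
    {Ω : Type*} [mΩ : MeasurableSpace Ω] (P : Measure Ω) where
  hist : Filtration ℕ mΩ
  /-- `arr k i` indicates the arrival of a packet for user `i` at the beginning of slot `k` -/
  arr : ℕ → RT ⊕ NRT → Ω → ℝ
  /-- `gain k i` is the power gain of user `i` in slot `k` -/
  gain : ℕ → RT ⊕ NRT → Ω → ℝ
  arr_mem : ∀ k i ω, arr k i ω = 0 ∨ arr k i ω = 1
  gain_mem : ∀ k i ω, gain k i ω ∈ Set.Icc 0 c.gmax
  arr_meas : ∀ k i, Measurable[hist (k + 1)] (arr k i)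
  gain_meas : ∀ k i, Measurable[hist (k + 1)] (gain k i)
  law : ∀ k, P.map (fun ω i => (arr k i ω, gain k i ω)) = s.slotLaw
  indep : ∀ k, Indep
    (MeasurableSpace.comap (fun ω (i : RT ⊕ NRT) => (arr k i ω, gain k i ω)) inferInstance)
    (hist k) P

/-- The decisions of a slot-based (non-anticipating, possibly randomized) algorithm. -/
structure Policy [Fintype RT] [Fintype NRT] {c : Cell RT} {s : Scenario c NRT}
    {Ω : Type*} [MeasurableSpace Ω] {P : Measure Ω} (d : Network s P) where
  /-- admission decisions -/
  r : ℕ → NRT → Ω → ℝ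
  /-- durations assigned to the users -/
  μ : ℕ → RT ⊕ NRT → Ω → ℝ
  /-- transmission powers -/
  p : ℕ → RT ⊕ NRT → Ω → ℝ
  r_meas : ∀ k i, Measurable[d.hist (k + 1)] (r k i)
  μ_meas : ∀ k i, Measurable[d.hist (k + 1)] (μ k i)
  p_meas : ∀ k i, Measurable[d.hist (k + 1)] (p k i)

/-- The transmission rate at power `p` and gain `g`. -/
def rate (p g : ℝ) : ℝ := Real.log (1 + p * g)

section Policies

variable [Fintype RT] [Fintype NRT] {c : Cell RT} {s : Scenario c NRT}
  {Ω : Type*} [MeasurableSpace Ω] {P : Measure Ω} {d : Network s P}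

/-- The number of bits that user `i` could be sent in slot `k`: duration times rate. -/
def Policy.service (π : Policy d) (k : ℕ) (i : RT ⊕ NRT) (ω : Ω) : ℝ :=
  π.μ k i ω * rate (π.p k i ω) (d.gain k i ω)

/-- The queues (in bits) of the non-real-time users. -/
def Policy.Q (π : Policy d) : ℕ → NRT → Ω → ℝ
  | 0, i, _ => s.Q₀ i
  | k + 1, i, ω => max (π.Q k i ω + c.L * π.r k i ω - π.service k (Sum.inr i) ω) 0

/-- The number of bits of non-real-time user `i` transmitted in slot `k`: the service, or the
whole content of the buffer if that is less. -/
def Policy.sent (π : Policy d) (k : ℕ) (i : NRT) (ω : Ω) : ℝ :=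
  min (π.service k (Sum.inr i) ω) (π.Q k i ω + c.L * π.r k i ω)

/-- The power spent in slot `k`, averaged over the slot. -/
def Policy.power (π : Policy d) (k : ℕ) (ω : Ω) : ℝ :=
  (∑ i, π.p k i ω * π.μ k i ω) / c.Ts

open Classical in
/-- The virtual queues of the delivery ratio constraints. -/
def Policy.Y (π : Policy d) : ℕ → RT → Ω → ℝ
  | 0, _, _ => 0
  | k + 1, i, ω => max (π.Y k i ω + d.arr k (Sum.inl i) ω * c.q i
      - (if π.μ k (Sum.inl i) ω ≠ 0 then 1 else 0)) 0

/-- The virtual queue of the average power constraint. -/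
def Policy.X (π : Policy d) : ℕ → Ω → ℝ
  | 0, _ => 0
  | k + 1, ω => max (π.X k ω + π.power k ω - c.Pavg) 0

/-- The time average over the first `K` slots of the expectation of `f k`. -/
def timeAvg (P : Measure Ω) (f : ℕ → Ω → ℝ) (K : ℕ) : ℝ :=
  (∑ k ∈ Finset.range K, ∫ ω, f k ω ∂P) / K

/-- The constraints of the throughput maximization problem. -/
structure Policy.Admissible (π : Policy d) : Prop where
  /-- only arriving packets are admitted -/
  admission : ∀ k i ω, (π.r k i ω = 0 ∨ π.r k i ω = 1) ∧ π.r k i ω ≤ d.arr k (Sum.inr i) ω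
  /-- a real-time user is either not scheduled, or has received a packet in this slot and is given
  the time that the transmission of the whole packet takes -/
  realTime : ∀ k i ω, π.μ k (Sum.inl i) ω = 0 ∨
    (d.arr k (Sum.inl i) ω = 1 ∧ π.service k (Sum.inl i) ω = c.L)
  peak : ∀ k i ω, 0 ≤ π.p k i ω ∧ π.p k i ω ≤ c.Pmax
  duration : ∀ k i ω, 0 ≤ π.μ k i ω ∧ π.μ k i ω ≤ c.Ts
  slot : ∀ k ω, ∑ i, π.μ k i ω = c.Ts
  /-- stability of the non-real-time queues -/
  stable : ∀ i, limsup (fun k => ∫⁻ ω, ENNReal.ofReal (π.Q k i ω) ∂P) atTop < ⊤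
  /-- delivery ratios of the real-time users -/
  delivery : ∀ i, s.lam (Sum.inl i) * c.q i ≤
    liminf (timeAvg P fun k ω => π.service k (Sum.inl i) ω / c.L) atTop
  /-- average power -/
  average : limsup (timeAvg P π.power) atTop ≤ c.Pavg

/-- The sum throughput of the non-real-time users, in packets per slot. -/
def Policy.throughput (π : Policy d) : ℝ :=
  liminf (timeAvg P fun k ω => ∑ i, π.sent k i ω / c.L) atTop

end Policies

/-- The throughput maximization problem is feasible. -/
def Feasible [Fintype RT] [Fintype NRT] {c : Cell RT} (s : Scenario c NRT) : Prop :=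
  ∃ (Ω : Type) (_ : MeasurableSpace Ω) (P : Measure Ω) (_ : IsProbabilityMeasure P)
    (d : Network s P) (π : Policy d), π.Admissible

/-- The optimal value of the throughput maximization problem. -/
def optimalThroughput [Fintype RT] [Fintype NRT] {c : Cell RT} (s : Scenario c NRT) : EReal :=
  sSup {t : EReal | ∃ (Ω : Type) (_ : MeasurableSpace Ω) (P : Measure Ω)
    (_ : IsProbabilityMeasure P) (d : Network s P) (π : Policy d),
    π.Admissible ∧ t = (π.throughput : ℝ)}

/-! ### The Lambert-Strict algorithm -/

/-- The water-filling power `min ((Ts Q / X - 1 / g)⁺) Pmax` of a non-real-time user with queue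
`Q` and gain `g`; the quotient is read as `+∞` if its denominator is zero and its numerator is
not, and the power is `0` if `Q = 0`. -/
def waterPower (c : Cell RT) (X Q g : ℝ) : ℝ :=
  if Q = 0 ∨ g = 0 then 0
  else if X = 0 then c.Pmax
  else min (max (c.Ts * Q / X - 1 / g) 0) c.Pmax

/-- `Ψ_NR`, the weight per unit of time of a non-real-time user under the water-filling power. -/
def nrtWeight (c : Cell RT) (X Q g : ℝ) : ℝ :=
  Q * rate (waterPower c X Q g) g - X * waterPower c X Q g / c.Ts

/-- The function `z ↦ z / W₀(z / e)`, with its limit `e` at the removable singularity `0`. -/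
def lambertRatio (z : ℝ) : ℝ :=
  if z = 0 then Real.exp 1 else z / lambertW (z / Real.exp 1)

/-- The Lambert power of a real-time user with gain `g`, where `t = (Ψ + φ) Ts / X` (read as `+∞`
if `X = 0`). -/
def lambertPower (c : Cell RT) (X Ψ φ g : ℝ) : ℝ :=
  if X = 0 then c.Pmax
  else min (1 / g * (lambertRatio ((Ψ + φ) * c.Ts / X * g - 1) - 1)) c.Pmax

/-- The sets of real-time users that the algorithm does not discard: all members have a packet and
a usable channel, and there are no available user `i` outside the set and `j` in the set such that
`i` has both a longer virtual queue and a larger gain. -/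
def Candidate (a g Y : RT → ℝ) (S : Finset RT) : Prop :=
  (∀ j ∈ S, a j = 1 ∧ 0 < g j) ∧
    ∀ i, i ∉ S → a i = 1 → ∀ j ∈ S, ¬ (Y j < Y i ∧ g j < g i)

/-- The powers `p` and durations `μ` of the real-time users, and the time `m` left to the
non-real-time user, when the set `S` is served with Lambert powers; `φ` is the multiplier of the
constraint `0 ≤ m`. -/
def LambertAllocation [Fintype RT] (c : Cell RT) (X Ψ : ℝ) (g : RT → ℝ) (S : Finset RT) (φ : ℝ)
    (p μ : RT → ℝ) (m : ℝ) : Prop :=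
  0 ≤ φ ∧
  (∀ i ∈ S, p i = lambertPower c X Ψ φ (g i) ∧ μ i * rate (p i) (g i) = c.L) ∧
  (∀ i, i ∉ S → p i = 0 ∧ μ i = 0) ∧
  m = c.Ts - ∑ i, μ i ∧ 0 ≤ m ∧ φ * m = 0

/-- The objective of the per-slot problem. -/
def slotValue (c : Cell RT) (X Ψ : ℝ) (Y : RT → ℝ) (S : Finset RT) (p μ : RT → ℝ) (m : ℝ) : ℝ :=
  ∑ i ∈ S, (Y i - X * p i * μ i / c.Ts) + Ψ * m

/-- The decisions `r`, `μ`, `p` are those of the Lambert-Strict algorithm with parameter `B` in a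
slot with arrivals `a`, gains `g`, queues `Q` and virtual queues `Y`, `X`. Ties are broken in any
way. -/
def LambertStrictSlot [Fintype RT] (c : Cell RT) (B : ℝ) (a g : RT ⊕ NRT → ℝ)
    (Q : NRT → ℝ) (Y : RT → ℝ) (X : ℝ) (r : NRT → ℝ) (μ p : RT ⊕ NRT → ℝ) : Prop :=
  (∀ i, (Q i < B → r i = a (Sum.inr i)) ∧ (B ≤ Q i → r i = 0)) ∧
  ∃ (n : NRT) (S : Finset RT) (φ : ℝ),
    let Ψ := fun i => nrtWeight c X (Q i) (g (Sum.inr i))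
    let aR := fun i => a (Sum.inl i)
    let gR := fun i => g (Sum.inl i)
    let pR := fun i => p (Sum.inl i)
    let μR := fun i => μ (Sum.inl i)
    (∀ i, Ψ i ≤ Ψ n) ∧
    p (Sum.inr n) = waterPower c X (Q n) (g (Sum.inr n)) ∧
    (∀ i, i ≠ n → p (Sum.inr i) = 0 ∧ μ (Sum.inr i) = 0) ∧
    Candidate aR gR Y S ∧
    LambertAllocation c X (Ψ n) gR S φ pR μR (μ (Sum.inr n)) ∧
    ∀ (S' : Finset RT) (φ' : ℝ) (p' μ' : RT → ℝ) (m' : ℝ),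
      Candidate aR gR Y S' → LambertAllocation c X (Ψ n) gR S' φ' p' μ' m' →
      slotValue c X (Ψ n) Y S' p' μ' m' ≤ slotValue c X (Ψ n) Y S pR μR (μ (Sum.inr n))

/-- The decisions `π` are those of the Lambert-Strict algorithm with parameter `B`. -/
def Policy.IsLambertStrict [Fintype RT] [Fintype NRT] {c : Cell RT} {s : Scenario c NRT}
    {Ω : Type*} [MeasurableSpace Ω] {P : Measure Ω} {d : Network s P}
    (π : Policy d) (B : ℝ) : Prop :=
  ∀ k ω, LambertStrictSlot c B (fun i => d.arr k i ω) (fun i => d.gain k i ω)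
    (fun i => π.Q k i ω) (fun i => π.Y k i ω) (π.X k ω)
    (fun i => π.r k i ω) (fun i => π.μ k i ω) (fun i => π.p k i ω)

end Scheduling

end

/-! The proof is a drift-plus-penalty argument. It needs no optimal stationary policy: the algorithm
is compared directly with every admissible policy through a Lagrangian bound.

Within a slot, the decisions maximize `slotObjective`, the queue-weighted service minus the weighted
power, over all feasible decisions (`LambertStrictSlot.optimal`). Time given to non-real-time users
is worth at most the largest water-filling weight `Ψ` per unit. For a fixed set `S` of real-time
users, a multiplier `φ` prices the slot length, and the cost of a packet becomes a function of its
rate alone. Its stationary point is what the Lambert function computes, and complementary slackness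
turns this into optimality for `S`. A suitable `φ` exists by the intermediate value theorem, and an
exchange argument shows that discarding non-candidate sets loses nothing.

Let `reward c B (θ, x)` be the best value of a slot `x` when the queues are replaced by arbitrary
weights `θ` and an admitted packet earns `B * L`. Averaging over time shows that every admissible
policy satisfies `B * L * throughput ≤ E[reward (θ, ·)]` for all nonnegative `θ`
(`Policy.Admissible.throughput_le_reward`); this is weak duality. The algorithm attains `reward`
with `θ` equal to its own queues, which are independent of the current slot, so its expected reward
is at least `B * L * t` for every achievable throughput `t`.

Inserted in the drift of half the sum of squared queues (`Policy.SlotAdmissible.lyapunov_succ_le`),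
this gives `E[V_K] ≤ E[V_0] + K (C - B L t) + B L E[admissions]`. Linear growth of `E[V_K]` makes
the expected virtual queues `O(√K)`, hence the constraints hold on average. Nonnegativity of `V_K`
bounds the admissions from below, and these differ from the transmissions by a bounded amount
because the queues are bounded. -/

namespace Scheduling

/-! ### The stationarity equation of the Lambert power -/

/-- The function `x ↦ (x - 1) e ^ x + 1` on `[0, ∞)`, extended by the identity. -/
noncomputable def stationarity (x : ℝ) : ℝ :=
  if 0 ≤ x then (x - 1) * Real.exp x + 1 else x

theorem stationarity_of_nonneg {x : ℝ} (hx : 0 ≤ x) :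
    stationarity x = (x - 1) * Real.exp x + 1 := if_pos hx

theorem sub_one_mul_exp_eq (x : ℝ) :
    (x - 1) * Real.exp x = ((x - 1) * Real.exp (x - 1)) * Real.exp 1 := by
  rw [mul_assoc, ← Real.exp_add]; ring_nf

/-- On `[0, ∞)` this is the monotonicity of `w * exp w` on `[-1, ∞)` after the shift `w = x - 1`.
Both branches vanish at `0`, so the extension is a continuous increasing bijection of the whole
line, and its inverse is continuous and monotone without domain restrictions. -/
theorem strictMono_stationarity : StrictMono stationarity := by
  have key : ∀ a b : ℝ, 0 ≤ a → a < b →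
      (a - 1) * Real.exp a + 1 < (b - 1) * Real.exp b + 1 := by
    intro a b ha hab
    have := mul_exp_lt_mul_exp (a := a - 1) (b := b - 1) (by linarith) (by linarith)
    have h2 := mul_lt_mul_of_pos_right this (Real.exp_pos 1)
    rw [← sub_one_mul_exp_eq, ← sub_one_mul_exp_eq] at h2
    linarith
  intro a b hab
  unfold stationarity
  split_ifs with ha hb hb
  · exact key a b ha hab
  · linarith
  · push Not at ha
    rcases hb.eq_or_lt with h0 | h0
    · rw [← h0]; simp; linarith
    · have := key 0 b le_rfl h0
      simp at this; linarith
  · exact hab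

theorem continuous_stationarity : Continuous stationarity := by
  unfold stationarity
  refine Continuous.if_le (by fun_prop) (by fun_prop) continuous_const continuous_id ?_
  intro x hx
  rw [← hx]; simp

theorem surjective_stationarity : Function.Surjective stationarity := by
  refine continuous_stationarity.surjective ?_ ?_
  · refine tendsto_atTop_mono' _ ?_ tendsto_id
    filter_upwards [eventually_ge_atTop 2] with x hx
    rw [stationarity_of_nonneg (by linarith)]
    have := Real.add_one_le_exp x
    simp only [id]
    nlinarith
  · refine tendsto_atBot_mono' _ ?_ tendsto_id
    filter_upwards [eventually_lt_atBot 0] with x hx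
    simp [stationarity, not_le.2 hx]

/-- `stationarity` as an order isomorphism of the real line. -/
noncomputable def stationarityIso : ℝ ≃o ℝ :=
  strictMono_stationarity.orderIsoOfSurjective _ surjective_stationarity

/-- The rate at which the Lagrangian of a real-time user is stationary. -/
noncomputable def lambertRate (y : ℝ) : ℝ := stationarityIso.symm y

theorem stationarity_lambertRate (y : ℝ) : stationarity (lambertRate y) = y :=
  stationarityIso.apply_symm_apply y

theorem continuous_lambertRate : Continuous lambertRate := stationarityIso.symm.continuous

theorem monotone_lambertRate : Monotone lambertRate := stationarityIso.symm.monotone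

theorem lambertRate_stationarity (x : ℝ) : lambertRate (stationarity x) = x :=
  stationarityIso.symm_apply_apply x

theorem stationarity_zero : stationarity 0 = 0 := by simp [stationarity]

theorem lambertRate_nonneg {y : ℝ} (hy : 0 ≤ y) : 0 ≤ lambertRate y := by
  have := monotone_lambertRate hy
  rwa [← stationarity_zero, lambertRate_stationarity] at this

theorem lambertRate_pos {y : ℝ} (hy : 0 < y) : 0 < lambertRate y := by
  have := stationarityIso.symm.strictMono hy
  change lambertRate 0 < lambertRate y at this
  rwa [← stationarity_zero, lambertRate_stationarity] at this

theorem lambertRate_eq {y : ℝ} (hy : 0 ≤ y) :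
    (lambertRate y - 1) * Real.exp (lambertRate y) = y - 1 := by
  have h := stationarity_lambertRate y
  rw [stationarity_of_nonneg (lambertRate_nonneg hy)] at h
  linarith

/-- With `x = lambertRate y ≥ 0`, stationarity reads `(x - 1) * exp (x - 1) = (y - 1) / e`. Since `x
- 1 ≥ -1` lies on the principal branch, `W₀ ((y - 1) / e) = x - 1`, and the quotient is `exp x`. The
value `e` at the singularity corresponds to `x = 1`. -/
theorem lambertRatio_eq {y : ℝ} (hy : 0 ≤ y) :
    lambertRatio (y - 1) = Real.exp (lambertRate y) := by
  have h0 := lambertRate_nonneg hy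
  have h := lambertRate_eq hy
  set x := lambertRate y
  have hW : lambertW ((y - 1) / Real.exp 1) = x - 1 := by
    rw [← h, sub_one_mul_exp_eq, mul_div_assoc, div_self (Real.exp_ne_zero 1), mul_one,
      lambertW_mul_exp (by linarith)]
  unfold lambertRatio
  split_ifs with hz
  · rw [hz] at h
    rcases mul_eq_zero.1 h with h1 | h1
    · rw [sub_eq_zero.1 h1]
    · exact absurd h1 (Real.exp_ne_zero x)
  · rw [hW, ← h, mul_div_cancel_left₀]
    intro h1
    rw [h1, zero_mul] at h
    exact hz h.symm

/-! ### Rates and powers -/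

theorem rate_nonneg {p g : ℝ} (hp : 0 ≤ p) (hg : 0 ≤ g) : 0 ≤ rate p g :=
  Real.log_nonneg (by nlinarith)

theorem rate_pos {p g : ℝ} (hp : 0 < p) (hg : 0 < g) : 0 < rate p g :=
  Real.log_pos (by nlinarith [mul_pos hp hg])

theorem rate_mono {p p' g g' : ℝ} (hp : 0 ≤ p) (hg : 0 ≤ g) (hpp : p ≤ p') (hgg : g ≤ g') :
    rate p g ≤ rate p' g' :=
  Real.log_le_log (by nlinarith [mul_nonneg hp hg])
    (by nlinarith [mul_le_mul hpp hgg hg (hp.trans hpp)])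

theorem exp_rate {p g : ℝ} (hp : 0 ≤ p) (hg : 0 ≤ g) : Real.exp (rate p g) = 1 + p * g :=
  Real.exp_log (by nlinarith [mul_nonneg hp hg])

/-! ### Water-filling and Lambert powers of a single user. -/

section Slot

variable {RT : Type*} (c : Cell RT)

theorem waterPower_mem (X Q g : ℝ) : 0 ≤ waterPower c X Q g ∧ waterPower c X Q g ≤ c.Pmax := by
  have := c.Pmax_pos.le
  unfold waterPower
  split_ifs
  · exact ⟨le_rfl, this⟩
  · exact ⟨this, le_rfl⟩
  · exact ⟨le_min (le_max_right _ _) this, min_le_right _ _⟩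

/-- The water-filling power maximizes the weight of a non-real-time user. -/
theorem le_nrtWeight {X Q g p : ℝ} (hX : 0 ≤ X) (hQ : 0 ≤ Q) (hg : 0 ≤ g) (hp : 0 ≤ p)
    (hp' : p ≤ c.Pmax) : Q * rate p g - X * p / c.Ts ≤ nrtWeight c X Q g := by
  have hTs := c.Ts_pos
  have hXp : 0 ≤ X * p / c.Ts := by positivity
  unfold nrtWeight
  by_cases h0 : Q = 0 ∨ g = 0
  · have hw : waterPower c X Q g = 0 := if_pos h0
    rw [hw]
    rcases h0 with h | h
    · simp [h]; exact hXp
    · simp [h, rate]; exact hXp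
  have hQ' : 0 < Q := lt_of_le_of_ne hQ (fun h => h0 (Or.inl h.symm))
  have hg' : 0 < g := lt_of_le_of_ne hg (fun h => h0 (Or.inr h.symm))
  by_cases hX0 : X = 0
  · have hw : waterPower c X Q g = c.Pmax := by simp [waterPower, h0, hX0]
    rw [hw, hX0]
    simp only [zero_mul, zero_div, sub_zero]
    exact mul_le_mul_of_nonneg_left (rate_mono hp hg hp' le_rfl) hQ
  have hX' : 0 < X := lt_of_le_of_ne hX (Ne.symm hX0)
  have hw : waterPower c X Q g = min (max (c.Ts * Q / X - 1 / g) 0) c.Pmax := by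
    simp [waterPower, h0, hX0]
  obtain ⟨hs0, hs1⟩ := waterPower_mem c X Q g
  set s := waterPower c X Q g
  have h1s : 0 < 1 + s * g := by positivity
  have h1p : 0 < 1 + p * g := by positivity
  -- Concavity of the logarithm: the rate lies below its tangent at `s`.
  have htan : rate p g ≤ rate s g + (p - s) * (g / (1 + s * g)) := by
    have := Real.log_le_sub_one_of_pos (div_pos h1p h1s)
    rw [Real.log_div h1p.ne' h1s.ne'] at this
    have e : (1 + p * g) / (1 + s * g) - 1 = (p - s) * (g / (1 + s * g)) := by
      field_simp; ring
    unfold rate; linarith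
  -- First-order condition at `s`. The derivative there has the sign of the untruncated water level
  -- minus `s`; it can be positive only at the cap `Pmax` and negative only at `0`.
  have hkey : (p - s) * (Q * g / (1 + s * g) - X / c.Ts) ≤ 0 := by
    have hle : c.Ts * Q / X - 1 / g ≤ s ∨ s = c.Pmax := by
      rw [hw]
      rcases le_total (max (c.Ts * Q / X - 1 / g) 0) c.Pmax with h | h
      · left; rw [min_eq_left h]; exact le_max_left _ _
      · right; exact min_eq_right h
    have hge : s ≤ c.Ts * Q / X - 1 / g ∨ s = 0 := by
      rw [hw]
      rcases le_total (c.Ts * Q / X - 1 / g) 0 with h | h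
      · right; rw [max_eq_right h]; exact min_eq_left c.Pmax_pos.le
      · left; rw [max_eq_left h]; exact min_le_left _ _
    have e : Q * g / (1 + s * g) - X / c.Ts
        = (c.Ts * Q / X - 1 / g - s) * (X * g / ((1 + s * g) * c.Ts)) := by
      field_simp; ring
    have hpos : 0 ≤ X * g / ((1 + s * g) * c.Ts) := by positivity
    rw [e, ← mul_assoc]
    refine mul_nonpos_of_nonpos_of_nonneg ?_ hpos
    rcases le_total p s with h | h
    · rcases hge with h' | h'
      · nlinarith
      · have : p = s := le_antisymm h (by rw [h']; exact hp)
        simp [this]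
    · rcases hle with h' | h'
      · nlinarith
      · have : p = s := le_antisymm (by rw [h']; exact hp') h
        simp [this]
  have h3 := mul_le_mul_of_nonneg_left htan hQ
  have e1 : (p - s) * (Q * g / (1 + s * g) - X / c.Ts)
      = Q * ((p - s) * (g / (1 + s * g))) - X * p / c.Ts + X * s / c.Ts := by ring
  linarith

theorem nrtWeight_nonneg {X Q g : ℝ} (hX : 0 ≤ X) (hQ : 0 ≤ Q) (hg : 0 ≤ g) :
    0 ≤ nrtWeight c X Q g := by
  have := le_nrtWeight c hX hQ hg le_rfl c.Pmax_pos.le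
  simpa [rate] using this

/-- The argument of `lambertRate` in the Lambert power. -/
noncomputable def multiplier (X w g : ℝ) : ℝ := w * c.Ts / X * g

theorem lambertPower_eq {X Ψ φ g : ℝ} (hX : 0 < X) (hw : 0 ≤ Ψ + φ) (hg : 0 < g) :
    lambertPower c X Ψ φ g
      = min ((Real.exp (lambertRate (multiplier c X (Ψ + φ) g)) - 1) / g) c.Pmax := by
  have hTs := c.Ts_pos
  have hy : 0 ≤ multiplier c X (Ψ + φ) g := by unfold multiplier; positivity
  unfold lambertPower
  rw [if_neg hX.ne', show (Ψ + φ) * c.Ts / X * g = multiplier c X (Ψ + φ) g from rfl,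
    lambertRatio_eq hy, one_div, inv_mul_eq_div]

theorem lambertPower_mem {X Ψ φ g : ℝ} (hX : 0 ≤ X) (hw : 0 ≤ Ψ + φ) (hg : 0 < g) :
    0 ≤ lambertPower c X Ψ φ g ∧ lambertPower c X Ψ φ g ≤ c.Pmax := by
  rcases hX.eq_or_lt with h | h
  · simp [lambertPower, ← h, c.Pmax_pos.le]
  · have hTs := c.Ts_pos
    rw [lambertPower_eq c h hw hg]
    refine ⟨le_min (div_nonneg ?_ hg.le) c.Pmax_pos.le, min_le_right _ _⟩
    have hy : 0 ≤ multiplier c X (Ψ + φ) g := by unfold multiplier; positivity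
    have := Real.one_le_exp (lambertRate_nonneg hy)
    linarith

/-- The rate increases with the power, so truncating the power at `Pmax` truncates the stationary
rate at the peak rate. In this form the dependence on `φ` is visibly continuous and monotone. -/
theorem rate_lambertPower {X Ψ φ g : ℝ} (hX : 0 < X) (hw : 0 ≤ Ψ + φ) (hg : 0 < g) :
    rate (lambertPower c X Ψ φ g) g
      = min (lambertRate (multiplier c X (Ψ + φ) g)) (rate c.Pmax g) := by
  rw [lambertPower_eq c hX hw hg]
  have hP := c.Pmax_pos
  have e : ∀ t, rate ((Real.exp t - 1) / g) g = t := by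
    intro t
    unfold rate
    rw [div_mul_cancel₀ _ hg.ne', add_sub_cancel, Real.log_exp]
  have h0 : 0 ≤ (Real.exp (lambertRate (multiplier c X (Ψ + φ) g)) - 1) / g := by
    have hTs := c.Ts_pos
    have hy : 0 ≤ multiplier c X (Ψ + φ) g := by unfold multiplier; positivity
    have := Real.one_le_exp (lambertRate_nonneg hy)
    exact div_nonneg (by linarith) hg.le
  rcases le_total ((Real.exp (lambertRate (multiplier c X (Ψ + φ) g)) - 1) / g) c.Pmax with h | h
  · rw [min_eq_left h, e, min_eq_left]
    have := rate_mono h0 hg.le h le_rfl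
    rwa [e] at this
  · rw [min_eq_right h, min_eq_right]
    have := rate_mono hP.le hg.le h le_rfl
    rwa [e] at this

/-- Minimality of the cost per bit, as a function of the rate, at a stationary point. -/
theorem costPerBit_le {A w x s : ℝ} (hA : 0 ≤ A) (hx : 0 < x) (hs : 0 < s)
    (hD : A * ((s - 1) * Real.exp s + 1) ≤ w)
    (h : A * ((s - 1) * Real.exp s + 1) = w ∨ x ≤ s) :
    (A * (Real.exp s - 1) + w) / s ≤ (A * (Real.exp x - 1) + w) / x := by
  rw [div_le_div_iff₀ hs hx]
  -- Tangent line of the exponential at `s`. After cross-multiplication it leaves exactly the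
  -- product in `h3` as a lower bound for the difference of the two sides.
  have h1 : Real.exp s * (x - s + 1) ≤ Real.exp x := by
    have := Real.add_one_le_exp (x - s)
    calc Real.exp s * (x - s + 1) ≤ Real.exp s * Real.exp (x - s) :=
          mul_le_mul_of_nonneg_left this (Real.exp_pos s).le
      _ = Real.exp x := by rw [← Real.exp_add]; ring_nf
  have h2 : A * s * (Real.exp s * (x - s + 1)) ≤ A * s * Real.exp x :=
    mul_le_mul_of_nonneg_left h1 (by positivity)
  -- Either `s` is stationary, or it is the peak rate, where the cost is still nonincreasing and
  -- only smaller rates `x` compete.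
  have h3 : 0 ≤ (w - A * ((s - 1) * Real.exp s + 1)) * (s - x) := by
    rcases h with h | h
    · rw [h]; simp
    · exact mul_nonneg (by linarith) (by linarith)
  nlinarith

/-- The Lambert power minimizes the Lagrangian cost of sending a packet. -/
theorem lambert_cost_le {X Ψ φ g μs p μ : ℝ} (hX : 0 ≤ X) (hw : 0 ≤ Ψ + φ) (hg : 0 < g)
    (hs : μs * rate (lambertPower c X Ψ φ g) g = c.L) (hp : 0 ≤ p) (hp' : p ≤ c.Pmax)
    (hμ : μ * rate p g = c.L) :
    X * lambertPower c X Ψ φ g * μs / c.Ts + (Ψ + φ) * μs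
      ≤ X * p * μ / c.Ts + (Ψ + φ) * μ := by
  have hL := c.L_pos
  have hTs := c.Ts_pos
  obtain ⟨hs0, -⟩ := lambertPower_mem c hX hw hg
  set P := lambertPower c X Ψ φ g with hP
  have hr : 0 < rate p g := lt_of_le_of_ne (rate_nonneg hp hg.le) fun h => by
    rw [← h, mul_zero] at hμ; exact hL.ne hμ
  have hrs : 0 < rate P g := lt_of_le_of_ne (rate_nonneg hs0 hg.le) fun h => by
    rw [← h, mul_zero] at hs; exact hL.ne hs
  have eμ : μ = c.L / rate p g := by rw [← hμ]; field_simp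
  have eμs : μs = c.L / rate P g := by rw [← hs]; field_simp
  -- If `X = 0`, power is free and only the duration costs; peak power minimizes it.
  rcases hX.eq_or_lt with h | h
  · have hPm : P = c.Pmax := by rw [hP]; simp [lambertPower, ← h]
    rw [← h]
    simp only [zero_mul, zero_div, zero_add]
    refine mul_le_mul_of_nonneg_left ?_ hw
    rw [eμ, eμs, hPm]
    exact div_le_div_of_nonneg_left hL.le hr (rate_mono hp hg.le hp' le_rfl)
  · have hy : 0 ≤ multiplier c X (Ψ + φ) g := by unfold multiplier; positivity
    have hrate := rate_lambertPower c h hw hg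
    rw [← hP] at hrate
    have hA : 0 < X / (g * c.Ts) := by positivity
    have hwA : X / (g * c.Ts) * multiplier c X (Ψ + φ) g = Ψ + φ := by
      unfold multiplier; field_simp
    -- Writing the power as `(exp x - 1) / g` and the duration as `L / x` makes the Lagrangian cost
    -- of a packet `L` times the cost per bit at rate `x`.
    have hcost := costPerBit_le (A := X / (g * c.Ts)) (w := Ψ + φ) (x := rate p g)
      (s := rate P g) hA.le hr hrs ?_ ?_
    · have e1 : X * P * μs / c.Ts + (Ψ + φ) * μs
          = c.L * ((X / (g * c.Ts) * (Real.exp (rate P g) - 1) + (Ψ + φ)) / rate P g) := by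
        rw [exp_rate hs0 hg.le, eμs]; field_simp; ring
      have e2 : X * p * μ / c.Ts + (Ψ + φ) * μ
          = c.L * ((X / (g * c.Ts) * (Real.exp (rate p g) - 1) + (Ψ + φ)) / rate p g) := by
        rw [exp_rate hp hg.le, eμ]; field_simp; ring
      rw [e1, e2]
      exact mul_le_mul_of_nonneg_left hcost hL.le
    · rw [← stationarity_of_nonneg hrs.le]
      calc X / (g * c.Ts) * stationarity (rate P g)
          ≤ X / (g * c.Ts) * stationarity (lambertRate (multiplier c X (Ψ + φ) g)) := by
            refine mul_le_mul_of_nonneg_left (strictMono_stationarity.monotone ?_) hA.le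
            rw [hrate]; exact min_le_left _ _
        _ = Ψ + φ := by rw [stationarity_lambertRate, hwA]
    · rcases le_total (lambertRate (multiplier c X (Ψ + φ) g)) (rate c.Pmax g) with h' | h'
      · left
        rw [min_eq_left h'] at hrate
        rw [← stationarity_of_nonneg hrs.le, hrate, stationarity_lambertRate, hwA]
      · right
        rw [hrate, min_eq_right h']
        exact rate_mono hp hg.le hp' le_rfl

end Slot

/-! ### Optimal service of a set of real-time users, and the choice of the set. -/

section Slot

variable {RT : Type*} (c : Cell RT)

/-- The powers `p` and durations `μ` transmit the packets of the users in `S` within one slot. -/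
structure Transmits (g : RT → ℝ) (S : Finset RT) (p μ : RT → ℝ) : Prop where
  gain_pos : ∀ i ∈ S, 0 < g i
  power : ∀ i ∈ S, 0 ≤ p i ∧ p i ≤ c.Pmax
  packet : ∀ i ∈ S, μ i * rate (p i) (g i) = c.L
  time : ∑ i ∈ S, μ i ≤ c.Ts

/-- The objective of the per-slot problem when the rest of the slot is left to the
non-real-time user. -/
noncomputable def splitValue (X Ψ : ℝ) (Y : RT → ℝ) (S : Finset RT) (p μ : RT → ℝ) : ℝ :=
  ∑ i ∈ S, (Y i - X * p i * μ i / c.Ts) + Ψ * (c.Ts - ∑ i ∈ S, μ i)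

variable {c}

theorem packet_pos {g p μ : ℝ} (hg : 0 ≤ g) (hp : 0 ≤ p) (h : μ * rate p g = c.L) :
    0 < rate p g ∧ 0 < μ ∧ μ = c.L / rate p g := by
  have hL := c.L_pos
  have hr : 0 < rate p g := lt_of_le_of_ne (rate_nonneg hp hg) fun h0 => by
    rw [← h0, mul_zero] at h; exact hL.ne h
  have e : μ = c.L / rate p g := by rw [← h]; field_simp
  exact ⟨hr, by rw [e]; positivity, e⟩

/-- Peak power gives the shortest transmission of every packet. This necessary condition for serving
`S` is also sufficient for a Lambert allocation, by `exists_lambertAllocation`. -/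
theorem Transmits.minTime_le {g : RT → ℝ} {S : Finset RT} {p μ : RT → ℝ}
    (h : Transmits c g S p μ) : ∑ i ∈ S, c.L / rate c.Pmax (g i) ≤ c.Ts := by
  refine le_trans (Finset.sum_le_sum fun i hi => ?_) h.time
  obtain ⟨hp, hp'⟩ := h.power i hi
  obtain ⟨hr, -, e⟩ := packet_pos (h.gain_pos i hi).le hp (h.packet i hi)
  rw [e]
  exact div_le_div_of_nonneg_left c.L_pos.le hr (rate_mono hp (h.gain_pos i hi).le hp' le_rfl)

variable [Fintype RT]

theorem LambertAllocation.sum_eq {X Ψ φ m : ℝ} {g p μ : RT → ℝ} {S : Finset RT}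
    (h : LambertAllocation c X Ψ g S φ p μ m) : ∑ i, μ i = ∑ i ∈ S, μ i := by
  symm
  exact Finset.sum_subset (Finset.subset_univ S) fun i _ hi => (h.2.2.1 i hi).2

theorem LambertAllocation.slotValue_eq {X Ψ φ m : ℝ} {g p μ Y : RT → ℝ} {S : Finset RT}
    (h : LambertAllocation c X Ψ g S φ p μ m) :
    slotValue c X Ψ Y S p μ m = splitValue c X Ψ Y S p μ := by
  unfold slotValue splitValue
  rw [h.2.2.2.1, h.sum_eq]

theorem LambertAllocation.transmits {X Ψ φ m : ℝ} {g p μ : RT → ℝ} {S : Finset RT}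
    (hX : 0 ≤ X) (hΨ : 0 ≤ Ψ) (hg : ∀ i ∈ S, 0 < g i)
    (h : LambertAllocation c X Ψ g S φ p μ m) : Transmits c g S p μ where
  gain_pos := hg
  power i hi := by
    rw [(h.2.1 i hi).1]
    exact lambertPower_mem c hX (add_nonneg hΨ h.1) (hg i hi)
  packet i hi := (h.2.1 i hi).2
  time := by
    have h1 := h.2.2.2.1
    have h2 := h.2.2.2.2.1
    rw [h.sum_eq] at h1
    linarith

/-- The Lambert allocation is optimal for its set of users. -/
theorem LambertAllocation.splitValue_le {X Ψ φ m : ℝ} {g p μ p' μ' Y : RT → ℝ} {S : Finset RT}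
    (hX : 0 ≤ X) (hΨ : 0 ≤ Ψ) (h : LambertAllocation c X Ψ g S φ p μ m)
    (h' : Transmits c g S p' μ') :
    splitValue c X Ψ Y S p' μ' ≤ splitValue c X Ψ Y S p μ := by
  obtain ⟨hφ, hS, -, hm, hm0, hφm⟩ := id h
  rw [h.sum_eq] at hm
  have key : ∑ i ∈ S, (X * p i * μ i / c.Ts + (Ψ + φ) * μ i)
      ≤ ∑ i ∈ S, (X * p' i * μ' i / c.Ts + (Ψ + φ) * μ' i) := by
    refine Finset.sum_le_sum fun i hi => ?_
    obtain ⟨hpi, hμi⟩ := hS i hi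
    rw [hpi] at hμi ⊢
    exact lambert_cost_le c hX (add_nonneg hΨ hφ) (h'.gain_pos i hi) hμi
      (h'.power i hi).1 (h'.power i hi).2 (h'.packet i hi)
  simp only [Finset.sum_add_distrib, ← Finset.mul_sum] at key
  unfold splitValue
  simp only [Finset.sum_sub_distrib]
  -- The `φ` terms are removed by duality: the competitor's slack time is nonnegative, while `φ * m
  -- = 0` for the Lambert allocation.
  have := mul_le_mul_of_nonneg_left h'.time hφ
  rw [hm] at hφm
  nlinarith

/-- Every set of users that can be served at peak power has a Lambert allocation. -/
theorem exists_lambertAllocation {X Ψ : ℝ} {g : RT → ℝ} {S : Finset RT} (hX : 0 ≤ X)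
    (hΨ : 0 ≤ Ψ) (hg : ∀ i ∈ S, 0 < g i) (hT : ∑ i ∈ S, c.L / rate c.Pmax (g i) ≤ c.Ts) :
    ∃ φ p μ m, LambertAllocation c X Ψ g S φ p μ m := by
  classical
  have hL := c.L_pos
  have hTs := c.Ts_pos
  have hPm : ∀ i ∈ S, 0 < rate c.Pmax (g i) := fun i hi => rate_pos c.Pmax_pos (hg i hi)
  have build : ∀ φ, 0 ≤ φ → (∀ i ∈ S, 0 < rate (lambertPower c X Ψ φ (g i)) (g i)) →
      ∑ i ∈ S, c.L / rate (lambertPower c X Ψ φ (g i)) (g i) ≤ c.Ts →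
      φ * (c.Ts - ∑ i ∈ S, c.L / rate (lambertPower c X Ψ φ (g i)) (g i)) = 0 →
      ∃ φ p μ m, LambertAllocation c X Ψ g S φ p μ m := by
    intro φ hφ hr hle hz
    refine ⟨φ, fun i => if i ∈ S then lambertPower c X Ψ φ (g i) else 0,
      fun i => if i ∈ S then c.L / rate (lambertPower c X Ψ φ (g i)) (g i) else 0,
      c.Ts - ∑ i ∈ S, c.L / rate (lambertPower c X Ψ φ (g i)) (g i), hφ, ?_, ?_, ?_, ?_, hz⟩
    · intro i hi
      simp only [hi, if_true, true_and]
      exact div_mul_cancel₀ _ (hr i hi).ne'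
    · intro i hi
      simp [hi]
    · simp [Finset.sum_ite_mem]
    · linarith
  rcases hX.eq_or_lt with h0 | h0
  · have e : ∀ i, lambertPower c X Ψ 0 (g i) = c.Pmax := fun i => by simp [lambertPower, ← h0]
    refine build 0 le_rfl ?_ ?_ (zero_mul _) <;> simp only [e]
    · exact hPm
    · exact hT
  -- `M φ` is the total time of the packets at multiplier `φ`. Unless `φ = 0` already fits, a root
  -- of `M φ = Ts` is sought.
  set M : ℝ → ℝ := fun φ => ∑ i ∈ S, c.L /
    min (lambertRate (multiplier c X (Ψ + φ) (g i))) (rate c.Pmax (g i)) with hM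
  have eM : ∀ φ, 0 ≤ φ →
      ∑ i ∈ S, c.L / rate (lambertPower c X Ψ φ (g i)) (g i) = M φ := fun φ hφ =>
    Finset.sum_congr rfl fun i hi => by
      rw [rate_lambertPower c h0 (add_nonneg hΨ hφ) (hg i hi)]
  have hmpos : ∀ φ, 0 < Ψ + φ → ∀ i ∈ S,
      0 < min (lambertRate (multiplier c X (Ψ + φ) (g i))) (rate c.Pmax (g i)) := by
    intro φ hφ i hi
    have := hg i hi
    exact lt_min (lambertRate_pos (by unfold multiplier; positivity)) (hPm i hi)
  have hpos : ∀ φ, 0 ≤ φ → 0 < Ψ + φ →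
      ∀ i ∈ S, 0 < rate (lambertPower c X Ψ φ (g i)) (g i) := by
    intro φ hφ hφ' i hi
    rw [rate_lambertPower c h0 hφ'.le (hg i hi)]
    exact hmpos φ hφ' i hi
  rcases S.eq_empty_or_nonempty with hS | ⟨j, hj⟩
  · subst hS
    exact build 0 le_rfl (by simp) (by simp [hTs.le]) (zero_mul _)
  by_cases hfree : 0 < Ψ ∧ M 0 ≤ c.Ts
  · refine build 0 le_rfl (hpos 0 le_rfl (by linarith [hfree.1])) ?_ (zero_mul _)
    rw [eM 0 le_rfl]; exact hfree.2
  -- At `Ψ + φ = 0` all rates vanish and the convention `L / 0 = 0` spoils `M`. So if `Ψ = 0`, the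
  -- left endpoint is chosen to give user `j` the stationary rate `L / Ts`; then `j` alone needs at
  -- least the whole slot.
  obtain ⟨φ₁, hφ₁, hφ₁', hM₁⟩ : ∃ φ₁, 0 ≤ φ₁ ∧ 0 < Ψ + φ₁ ∧ c.Ts ≤ M φ₁ := by
    rcases hΨ.eq_or_lt with h | h
    · have hgj := hg j hj
      have hst : 0 < stationarity (c.L / c.Ts) := by
        rw [← stationarity_zero]; exact strictMono_stationarity (by positivity)
      refine ⟨stationarity (c.L / c.Ts) * X / (g j * c.Ts), by positivity, ?_, ?_⟩
      · rw [← h, zero_add]; positivity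
      · have hp : 0 < Ψ + stationarity (c.L / c.Ts) * X / (g j * c.Ts) := by
          rw [← h, zero_add]; positivity
        have e : multiplier c X (Ψ + stationarity (c.L / c.Ts) * X / (g j * c.Ts)) (g j)
            = stationarity (c.L / c.Ts) := by
          unfold multiplier; rw [← h, zero_add]; field_simp
        refine le_trans ?_ (Finset.single_le_sum (fun i hi => ?_) hj)
        · rw [e, lambertRate_stationarity]
          rw [le_div_iff₀ (lt_min (by positivity) (hPm j hj))]
          calc c.Ts * min (c.L / c.Ts) (rate c.Pmax (g j)) ≤ c.Ts * (c.L / c.Ts) :=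
                mul_le_mul_of_nonneg_left (min_le_left _ _) hTs.le
            _ = c.L := by field_simp
        · exact div_nonneg hL.le (hmpos _ hp i hi).le
    · exact ⟨0, le_rfl, by linarith, (not_le.1 fun h' => hfree ⟨h, h'⟩).le⟩
  -- For a large multiplier every stationary rate exceeds the peak rate, and `M` equals the minimal
  -- time, which fits by hypothesis.
  obtain ⟨φ₂, hφ₂, hM₂⟩ : ∃ φ₂, φ₁ ≤ φ₂ ∧ M φ₂ ≤ c.Ts := by
    obtain ⟨b, hb⟩ : ∃ b, ∀ i ∈ S, stationarity (rate c.Pmax (g i)) * X / (c.Ts * g i) ≤ b := by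
      obtain ⟨b, hb⟩ := (S.image fun i =>
        stationarity (rate c.Pmax (g i)) * X / (c.Ts * g i)).bddAbove
      exact ⟨b, fun i hi => hb (by simpa using ⟨i, hi, rfl⟩)⟩
    refine ⟨max φ₁ b, le_max_left _ _, le_trans (le_of_eq ?_) hT⟩
    refine Finset.sum_congr rfl fun i hi => ?_
    rw [min_eq_right]
    rw [← lambertRate_stationarity (rate c.Pmax (g i))]
    refine monotone_lambertRate ?_
    have hgi := hg i hi
    have h1 : stationarity (rate c.Pmax (g i)) * X / (c.Ts * g i) ≤ Ψ + max φ₁ b :=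
      (hb i hi).trans ((le_max_right _ _).trans (by linarith))
    rw [div_le_iff₀ (by positivity)] at h1
    unfold multiplier
    rw [div_mul_eq_mul_div, le_div_iff₀ h0]
    linarith
  have hcont : ContinuousOn M (Set.Icc φ₁ φ₂) := by
    refine continuousOn_finsetSum _ fun i hi => ?_
    refine ContinuousOn.div continuousOn_const ?_ fun φ hφ =>
      (hmpos φ (by linarith [hφ.1]) i hi).ne'
    refine Continuous.continuousOn ?_
    refine Continuous.min (continuous_lambertRate.comp ?_) continuous_const
    unfold multiplier
    fun_prop
  obtain ⟨φ, hφ, hMφ⟩ := intermediate_value_Icc' hφ₂ hcont ⟨hM₂, hM₁⟩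
  have hφ0 : 0 ≤ φ := hφ₁.trans hφ.1
  refine build φ hφ0 (hpos φ hφ0 (by linarith [hφ.1])) ?_ ?_
  · rw [eM φ hφ0, hMφ]
  · rw [eM φ hφ0, hMφ, sub_self, mul_zero]

/-- Some candidate set with a Lambert allocation is at least as good as any way of transmitting
packets of available users. -/
theorem exists_candidate_ge {X Ψ : ℝ} {a g Y : RT → ℝ} {S : Finset RT} {p μ : RT → ℝ}
    (hX : 0 ≤ X) (hΨ : 0 ≤ Ψ) (h : Transmits c g S p μ) (ha : ∀ i ∈ S, a i = 1) :
    ∃ S' φ p' μ' m, Candidate a g Y S' ∧ LambertAllocation c X Ψ g S' φ p' μ' m ∧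
      splitValue c X Ψ Y S p μ ≤ splitValue c X Ψ Y S' p' μ' := by
  classical
  have hTs := c.Ts_pos
  let F : Finset (Finset RT) := Finset.univ.filter fun S =>
    (∀ i ∈ S, a i = 1 ∧ 0 < g i) ∧ ∑ i ∈ S, c.L / rate c.Pmax (g i) ≤ c.Ts
  have hall : ∀ S ∈ F, ∃ φ p μ m, LambertAllocation c X Ψ g S φ p μ m := by
    intro S hS
    have hS := (Finset.mem_filter.1 hS).2
    exact exists_lambertAllocation hX hΨ (fun i hi => (hS.1 i hi).2) hS.2
  choose! φ p' μ' m hA using hall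
  have hSF : ∀ S p μ, Transmits c g S p μ → (∀ i ∈ S, a i = 1) → S ∈ F := by
    intro S p μ h ha
    simp only [F, Finset.mem_filter, Finset.mem_univ, true_and]
    exact ⟨fun i hi => ⟨ha i hi, h.gain_pos i hi⟩, h.minTime_le⟩
  -- The best of all servable sets is taken, with no regard to the candidate condition; the
  -- condition then follows from maximality.
  obtain ⟨S', hS', hmax⟩ := Finset.exists_max_image F
    (fun S => splitValue c X Ψ Y S (p' S) (μ' S)) ⟨S, hSF S p μ h ha⟩
  refine ⟨S', φ S', p' S', μ' S', m S', ?_, hA S' hS', ?_⟩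
  swap
  · exact ((hA S (hSF S p μ h ha)).splitValue_le hX hΨ h).trans (hmax S (hSF S p μ h ha))
  have hS'' := (Finset.mem_filter.1 hS').2.1
  refine ⟨hS'', ?_⟩
  rintro i hi hai j hj ⟨hY, hgij⟩
  have hT := (hA S' hS').transmits hX hΨ fun i hi => (hS'' i hi).2
  set ps := p' S'
  set μs := μ' S'
  have hgj : 0 < g j := (hS'' j hj).2
  have hgi : 0 < g i := hgj.trans hgij
  -- Exchange argument: `i` replaces `j` with the same duration and the same received power `p * g`,
  -- hence the same rate. The better channel needs no more transmit power, and `Y i > Y j`, so the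
  -- value would strictly increase.
  let q : RT → ℝ := fun k => if k = i then ps j * g j / g i else ps k
  let ν : RT → ℝ := fun k => if k = i then μs j else μs k
  have hie : i ∉ S'.erase j := fun h => hi (Finset.mem_of_mem_erase h)
  have hne : ∀ k ∈ S'.erase j, k ≠ i := fun k hk h => hie (h ▸ hk)
  obtain ⟨hp0, hp1⟩ := hT.power j hj
  have hμj := (packet_pos hgj.le hp0 (hT.packet j hj)).2.1
  have hqi : ps j * g j / g i ≤ ps j := by
    rw [div_le_iff₀ hgi]; exact mul_le_mul_of_nonneg_left hgij.le hp0
  have hsum : ∀ f f' : RT → ℝ, (∀ k, k ≠ i → f k = f' k) →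
      ∑ k ∈ insert i (S'.erase j), f k = f i - f' j + ∑ k ∈ S', f' k := by
    intro f f' hf
    rw [Finset.sum_insert hie, ← Finset.add_sum_erase S' f' hj,
      Finset.sum_congr rfl fun k hk => hf k (hne k hk)]
    ring
  have hν : ∑ k ∈ insert i (S'.erase j), ν k = ∑ k ∈ S', μs k := by
    rw [hsum ν μs fun k hk => by simp [ν, hk]]; simp [ν]
  have hT' : Transmits c g (insert i (S'.erase j)) q ν := by
    refine ⟨fun k hk => ?_, fun k hk => ?_, fun k hk => ?_, ?_⟩
    · rcases Finset.mem_insert.1 hk with rfl | hk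
      · exact hgi
      · exact (hS'' k (Finset.mem_of_mem_erase hk)).2
    · rcases Finset.mem_insert.1 hk with rfl | hk
      · simp only [q, if_true]
        exact ⟨by positivity, hqi.trans hp1⟩
      · simp only [q, hne k hk, if_false]
        exact hT.power k (Finset.mem_of_mem_erase hk)
    · rcases Finset.mem_insert.1 hk with rfl | hk
      · simp only [q, ν, if_true]
        have := hT.packet j hj
        unfold rate at this ⊢
        rwa [div_mul_cancel₀ _ hgi.ne']
      · simp only [q, ν, hne k hk, if_false]
        exact hT.packet k (Finset.mem_of_mem_erase hk)
    · rw [hν]; exact hT.time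
  have haT : ∀ k ∈ insert i (S'.erase j), a k = 1 := by
    intro k hk
    rcases Finset.mem_insert.1 hk with rfl | hk
    · exact hai
    · exact (hS'' k (Finset.mem_of_mem_erase hk)).1
  have hF := hSF _ _ _ hT' haT
  have h1 := ((hA _ hF).splitValue_le (Y := Y) hX hΨ hT').trans (hmax _ hF)
  have h2 : splitValue c X Ψ Y S' ps μs < splitValue c X Ψ Y (insert i (S'.erase j)) q ν := by
    unfold splitValue
    rw [hν, hsum (fun k => Y k - X * q k * ν k / c.Ts) (fun k => Y k - X * ps k * μs k / c.Ts)
      fun k hk => by simp [q, ν, hk]]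
    have : X * q i * ν i / c.Ts ≤ X * ps j * μs j / c.Ts := by
      simp only [q, ν, if_true]
      gcongr
    linarith
  exact absurd h1 (not_le.2 h2)

end Slot

/-! ### Optimality of the Lambert-Strict decisions -/

section Decisions

variable {RT NRT : Type*} [Fintype RT] [Fintype NRT] (c : Cell RT)

/-- The durations `μ` and powers `p` are allowed in a slot with arrivals `a` and gains `g`. -/
structure SlotFeasible (a g μ p : RT ⊕ NRT → ℝ) : Prop where
  realTime : ∀ i : RT, μ (Sum.inl i) = 0 ∨ (a (Sum.inl i) = 1 ∧
    μ (Sum.inl i) * rate (p (Sum.inl i)) (g (Sum.inl i)) = c.L)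
  peak : ∀ i, 0 ≤ p i ∧ p i ≤ c.Pmax
  duration : ∀ i, 0 ≤ μ i ∧ μ i ≤ c.Ts
  slot : ∑ i, μ i = c.Ts

/-- The weighted service minus the weighted power of a decision. -/
noncomputable def slotObjective (Q : NRT → ℝ) (Y : RT → ℝ) (X : ℝ) (g μ p : RT ⊕ NRT → ℝ) : ℝ :=
  ∑ i : RT, Y i * (μ (Sum.inl i) * rate (p (Sum.inl i)) (g (Sum.inl i)) / c.L)
    + ∑ i : NRT, Q i * (μ (Sum.inr i) * rate (p (Sum.inr i)) (g (Sum.inr i)))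
    - X * ((∑ i, p i * μ i) / c.Ts)

variable {c}

/-- `S` consists of the real-time users with nonzero duration; each sends exactly one packet and so
contributes `Y i`. The remaining time goes to non-real-time users, who earn at most `Ψ` per unit of
it by water-filling. -/
theorem SlotFeasible.slotObjective_le {a g μ p : RT ⊕ NRT → ℝ} {Q : NRT → ℝ} {Y : RT → ℝ}
    {X Ψ : ℝ} (hQ : ∀ i, 0 ≤ Q i) (hX : 0 ≤ X) (hg : ∀ i, 0 ≤ g i)
    (h : SlotFeasible c a g μ p) (hΨ : ∀ i, nrtWeight c X (Q i) (g (Sum.inr i)) ≤ Ψ) :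
    ∃ S : Finset RT, Transmits c (fun i => g (Sum.inl i)) S (fun i => p (Sum.inl i))
      (fun i => μ (Sum.inl i)) ∧ (∀ i ∈ S, a (Sum.inl i) = 1) ∧
      slotObjective c Q Y X g μ p
        ≤ splitValue c X Ψ Y S (fun i => p (Sum.inl i)) (fun i => μ (Sum.inl i)) := by
  classical
  have hL := c.L_pos
  have hTs := c.Ts_pos
  let S : Finset RT := Finset.univ.filter fun i => μ (Sum.inl i) ≠ 0
  have hS : ∀ i ∈ S, a (Sum.inl i) = 1 ∧
      μ (Sum.inl i) * rate (p (Sum.inl i)) (g (Sum.inl i)) = c.L := fun i hi =>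
    (h.realTime i).resolve_left (Finset.mem_filter.1 hi).2
  have hsum : ∀ f : RT → ℝ, (∀ i, μ (Sum.inl i) = 0 → f i = 0) → ∑ i, f i = ∑ i ∈ S, f i := by
    intro f hf
    symm
    refine Finset.sum_subset (Finset.subset_univ S) fun i _ hi => hf i ?_
    by_contra h0
    exact hi (Finset.mem_filter.2 ⟨Finset.mem_univ i, h0⟩)
  have hslot := h.slot
  rw [Fintype.sum_sum_type, hsum (fun i => μ (Sum.inl i)) fun i hi => hi] at hslot
  have hnrt : 0 ≤ ∑ i : NRT, μ (Sum.inr i) := Finset.sum_nonneg fun i _ => (h.duration _).1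
  refine ⟨S, ⟨fun i hi => ?_, fun i hi => h.peak _, fun i hi => (hS i hi).2, by linarith⟩,
    fun i hi => (hS i hi).1, ?_⟩
  · refine lt_of_le_of_ne (hg _) fun h0 => ?_
    have := (hS i hi).2
    rw [← h0] at this
    simp [rate] at this
    exact hL.ne this
  unfold slotObjective splitValue
  rw [Fintype.sum_sum_type, hsum (fun i => p (Sum.inl i) * μ (Sum.inl i)) (by simp +contextual),
    hsum (fun i => Y i * (μ (Sum.inl i) * rate (p (Sum.inl i)) (g (Sum.inl i)) / c.L))
      (by simp +contextual),
    Finset.sum_congr rfl fun i hi => by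
      rw [(hS i hi).2, div_self hL.ne', mul_one],
    Finset.sum_sub_distrib]
  have e1 : ∑ i ∈ S, X * p (Sum.inl i) * μ (Sum.inl i) / c.Ts
      = X * ((∑ i ∈ S, p (Sum.inl i) * μ (Sum.inl i)) / c.Ts) := by
    rw [Finset.sum_div, Finset.mul_sum]
    exact Finset.sum_congr rfl fun i _ => by ring
  have e2 : ∑ i : NRT, Q i * (μ (Sum.inr i) * rate (p (Sum.inr i)) (g (Sum.inr i)))
      - X * ((∑ i : NRT, p (Sum.inr i) * μ (Sum.inr i)) / c.Ts)
      ≤ Ψ * ∑ i : NRT, μ (Sum.inr i) := by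
    rw [Finset.sum_div, Finset.mul_sum, Finset.mul_sum, ← Finset.sum_sub_distrib]
    refine Finset.sum_le_sum fun i _ => ?_
    have h1 := (le_nrtWeight c hX (hQ i) (hg (Sum.inr i)) (h.peak (Sum.inr i)).1
      (h.peak (Sum.inr i)).2).trans (hΨ i)
    have h2 := mul_le_mul_of_nonneg_right h1 (h.duration (Sum.inr i)).1
    calc _ = (Q i * rate (p (Sum.inr i)) (g (Sum.inr i)) - X * p (Sum.inr i) / c.Ts)
          * μ (Sum.inr i) := by ring
      _ ≤ _ := h2
  have e3 : c.Ts - ∑ i ∈ S, μ (Sum.inl i) = ∑ i : NRT, μ (Sum.inr i) := by linarith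
  rw [e1, e3, add_div, mul_add]
  linarith

section LambertStrict

variable {B : ℝ} {a g : RT ⊕ NRT → ℝ} {Q : NRT → ℝ} {Y : RT → ℝ} {X : ℝ} {r : NRT → ℝ}
  {μ p : RT ⊕ NRT → ℝ}

theorem LambertStrictSlot.feasible (hQ : ∀ i, 0 ≤ Q i) (hX : 0 ≤ X) (hg : ∀ i, 0 ≤ g i)
    (h : LambertStrictSlot c B a g Q Y X r μ p) : SlotFeasible c a g μ p := by
  classical
  obtain ⟨-, n, S, φ, hmax, hpn, hother, hcand, halloc, -⟩ := h
  have hΨ := nrtWeight_nonneg c hX (hQ n) (hg (Sum.inr n))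
  have hT := halloc.transmits hX hΨ fun i hi => (hcand.1 i hi).2
  have hoff := halloc.2.2.1
  have hm := halloc.2.2.2.1
  have hm0 := halloc.2.2.2.2.1
  have hμ0 : ∀ i, 0 ≤ μ i := by
    rintro (i | i)
    · by_cases hi : i ∈ S
      · exact (packet_pos (hT.gain_pos i hi).le (hT.power i hi).1 (hT.packet i hi)).2.1.le
      · exact (hoff i hi).2.ge
    · by_cases hi : i = n
      · rw [hi]; exact hm0
      · exact (hother i hi).2.ge
  have hslot : ∑ i, μ i = c.Ts := by
    rw [Fintype.sum_sum_type, Finset.sum_eq_single n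
      (fun i _ hi => (hother i hi).2) (by simp), hm]
    ring
  refine ⟨fun i => ?_, ?_, fun i => ⟨hμ0 i, ?_⟩, hslot⟩
  · by_cases hi : i ∈ S
    · exact Or.inr ⟨(hcand.1 i hi).1, hT.packet i hi⟩
    · exact Or.inl (hoff i hi).2
  · rintro (i | i)
    · by_cases hi : i ∈ S
      · exact hT.power i hi
      · rw [show p (Sum.inl i) = 0 from (hoff i hi).1]; exact ⟨le_rfl, c.Pmax_pos.le⟩
    · by_cases hi : i = n
      · rw [hi, hpn]; exact waterPower_mem c _ _ _
      · rw [(hother i hi).1]; exact ⟨le_rfl, c.Pmax_pos.le⟩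
  · rw [← hslot]
    exact Finset.single_le_sum (fun j _ => hμ0 j) (Finset.mem_univ i)

/-- A competing decision is dominated by the split value of its set of users, then by a candidate
set with a Lambert allocation, and finally by the maximal choice of the algorithm. -/
theorem LambertStrictSlot.optimal (hQ : ∀ i, 0 ≤ Q i) (hX : 0 ≤ X) (hg : ∀ i, 0 ≤ g i)
    (h : LambertStrictSlot c B a g Q Y X r μ p) {μ' p' : RT ⊕ NRT → ℝ}
    (h' : SlotFeasible c a g μ' p') :
    slotObjective c Q Y X g μ' p' ≤ slotObjective c Q Y X g μ p := by
  classical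
  obtain ⟨-, n, S, φ, hmax, hpn, hother, hcand, halloc, hbest⟩ := h
  have hL := c.L_pos
  have hΨ := nrtWeight_nonneg c hX (hQ n) (hg (Sum.inr n))
  obtain ⟨S₁, hT₁, ha₁, hle₁⟩ := h'.slotObjective_le (Y := Y) hQ hX hg hmax
  obtain ⟨S₂, φ₂, p₂, μ₂, m₂, hc₂, hA₂, hle₂⟩ :=
    exists_candidate_ge (a := fun i => a (Sum.inl i)) (Y := Y) hX hΨ hT₁ ha₁
  have hle₃ := hbest S₂ φ₂ p₂ μ₂ m₂ hc₂ hA₂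
  rw [hA₂.slotValue_eq] at hle₃
  refine (hle₁.trans (hle₂.trans hle₃)).trans (le_of_eq ?_)
  have hoff := halloc.2.2.1
  have hpk := fun i hi => (halloc.2.1 i hi).2
  unfold slotObjective slotValue
  have e1 : ∑ i, Y i * (μ (Sum.inl i) * rate (p (Sum.inl i)) (g (Sum.inl i)) / c.L)
      = ∑ i ∈ S, Y i := by
    rw [← Finset.sum_subset (Finset.subset_univ S)]
    · exact Finset.sum_congr rfl fun i hi => by
        rw [hpk i hi, div_self hL.ne', mul_one]
    · intro i _ hi
      rw [show μ (Sum.inl i) = 0 from (hoff i hi).2]; simp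
  have e2 : ∑ i : RT, p (Sum.inl i) * μ (Sum.inl i) = ∑ i ∈ S, p (Sum.inl i) * μ (Sum.inl i) := by
    rw [← Finset.sum_subset (Finset.subset_univ S)]
    intro i _ hi
    rw [show μ (Sum.inl i) = 0 from (hoff i hi).2]; simp
  rw [Fintype.sum_sum_type, e1, e2,
    Finset.sum_eq_single (f := fun i : NRT =>
      Q i * (μ (Sum.inr i) * rate (p (Sum.inr i)) (g (Sum.inr i)))) n
      (fun i _ hi => by rw [(hother i hi).2]; simp) (by simp),
    Finset.sum_eq_single (f := fun i : NRT => p (Sum.inr i) * μ (Sum.inr i)) n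
      (fun i _ hi => by rw [(hother i hi).2]; simp) (by simp), hpn]
  have e3 : ∑ i ∈ S, X * p (Sum.inl i) * μ (Sum.inl i) / c.Ts
      = X * ((∑ i ∈ S, p (Sum.inl i) * μ (Sum.inl i)) / c.Ts) := by
    rw [Finset.sum_div, Finset.mul_sum]
    exact Finset.sum_congr rfl fun i _ => by ring
  rw [Finset.sum_sub_distrib, e3]
  unfold nrtWeight
  ring

end LambertStrict

end Decisions

/-! ### Measurability of the optimal value of a slot -/

theorem isGreatest_sSup_fiber {E D : Type*} [TopologicalSpace E] [TopologicalSpace D]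
    [CompactSpace D] {C : Set (E × D)} (hC : IsClosed C) {J : E × D → ℝ} (hJ : Continuous J)
    (hne : ∀ z, ∃ d, (z, d) ∈ C) (z : E) :
    IsGreatest ((fun d => J (z, d)) '' {d | (z, d) ∈ C})
      (sSup ((fun d => J (z, d)) '' {d | (z, d) ∈ C})) := by
  have hcl : IsClosed {d | (z, d) ∈ C} := hC.preimage (by fun_prop : Continuous fun d => (z, d))
  have hcpt : IsCompact ((fun d => J (z, d)) '' {d | (z, d) ∈ C}) :=
    hcl.isCompact.image (by fun_prop)
  exact hcpt.isGreatest_sSup (Set.Nonempty.image _ (hne z))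

/-- The maximum of a continuous function over the compact fibers of a closed relation is
measurable. -/
theorem measurable_sSup_fiber {E D : Type*} [TopologicalSpace E] [MeasurableSpace E]
    [OpensMeasurableSpace E] [TopologicalSpace D] [CompactSpace D] {C : Set (E × D)}
    (hC : IsClosed C) {J : E × D → ℝ} (hJ : Continuous J) (hne : ∀ z, ∃ d, (z, d) ∈ C) :
    Measurable fun z => sSup ((fun d => J (z, d)) '' {d | (z, d) ∈ C}) := by
  refine measurable_of_Ici fun b => ?_
  -- Since the maximum is attained, a superlevel set is the projection of a closed set along a
  -- compact factor, hence closed.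
  have hcl : IsClosed (Prod.fst '' (C ∩ {y : E × D | b ≤ J y})) :=
    isClosedMap_fst_of_compactSpace _ (hC.inter (isClosed_le continuous_const hJ))
  convert hcl.measurableSet using 1
  ext z
  obtain ⟨⟨d, hd, hdJ⟩, hub⟩ := isGreatest_sSup_fiber hC hJ hne z
  constructor
  · intro hz
    refine ⟨(z, d), ⟨hd, ?_⟩, rfl⟩
    have : b ≤ sSup ((fun d => J (z, d)) '' {d | (z, d) ∈ C}) := hz
    rw [← hdJ] at this
    exact this
  · rintro ⟨⟨z', d'⟩, ⟨h1, h2⟩, rfl⟩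
    exact le_trans (show b ≤ J (z', d') from h2) (hub ⟨d', h1, rfl⟩)

/-- A continuous function on the plane that agrees with `rate` on the quadrant. -/
noncomputable def absRate (p g : ℝ) : ℝ := Real.log (1 + |p * g|)

theorem absRate_eq {p g : ℝ} (hp : 0 ≤ p) (hg : 0 ≤ g) : absRate p g = rate p g := by
  unfold absRate rate; rw [abs_of_nonneg (mul_nonneg hp hg)]

theorem continuous_absRate : Continuous fun y : ℝ × ℝ => absRate y.1 y.2 := by
  unfold absRate
  exact Continuous.log (by fun_prop) fun y => by positivity

/-! ### The per-slot problem as a maximization over a compact box. -/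

section SlotMax

variable {RT NRT : Type*} [Fintype RT] [Fintype NRT] (c : Cell RT)

/-- The queues of the non-real-time users, the virtual queues of the real-time users and the
virtual queue of the power constraint. -/
abbrev QueueState (RT NRT : Type*) := (NRT → ℝ) × (RT → ℝ) × ℝ

/-- Arrivals and gains in a slot. -/
abbrev SlotState (RT NRT : Type*) := RT ⊕ NRT → ℝ × ℝ

/-- Durations and powers within their bounds. -/
abbrev DecisionBox (NRT : Type*) (c : Cell RT) :=
  (RT ⊕ NRT → Set.Icc 0 c.Ts) × (RT ⊕ NRT → Set.Icc 0 c.Pmax)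

/-- The relation between slots and feasible decisions. -/
def feasibleRel : Set ((QueueState RT NRT × SlotState RT NRT) × DecisionBox NRT c) :=
  {y | (∀ i : RT, (y.2.1 (Sum.inl i) : ℝ) = 0 ∨ ((y.1.2 (Sum.inl i)).1 = 1 ∧
    (y.2.1 (Sum.inl i) : ℝ) * absRate (y.2.2 (Sum.inl i)) (y.1.2 (Sum.inl i)).2 = c.L)) ∧
    ∑ i, (y.2.1 i : ℝ) = c.Ts}

/-- The objective of a slot, as a continuous function. -/
noncomputable def boxObjective
    (y : (QueueState RT NRT × SlotState RT NRT) × DecisionBox NRT c) : ℝ :=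
  ∑ i : RT, y.1.1.2.1 i * ((y.2.1 (Sum.inl i) : ℝ)
      * absRate (y.2.2 (Sum.inl i)) (y.1.2 (Sum.inl i)).2 / c.L)
    + ∑ i : NRT, y.1.1.1 i * ((y.2.1 (Sum.inr i) : ℝ)
      * absRate (y.2.2 (Sum.inr i)) (y.1.2 (Sum.inr i)).2)
    - y.1.1.2.2 * ((∑ i, (y.2.2 i : ℝ) * y.2.1 i) / c.Ts)

/-- The optimal value of the objective of a slot. -/
noncomputable def slotMax (z : QueueState RT NRT × SlotState RT NRT) : ℝ :=
  sSup ((fun d => boxObjective c (z, d)) '' {d | (z, d) ∈ feasibleRel c})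

omit [Fintype RT] [Fintype NRT] in
theorem continuous_absRate_comp (i : RT ⊕ NRT) :
    Continuous fun y : (QueueState RT NRT × SlotState RT NRT) × DecisionBox NRT c =>
      absRate (y.2.2 i) (y.1.2 i).2 :=
  continuous_absRate.comp (f := fun y : (QueueState RT NRT × SlotState RT NRT) ×
    DecisionBox NRT c => (((y.2.2 i : ℝ)), (y.1.2 i).2)) (by fun_prop)

theorem isClosed_feasibleRel : IsClosed (feasibleRel (NRT := NRT) c) := by
  unfold feasibleRel
  simp only [Set.ofPred_and, Set.ofPred_forall, Set.ofPred_or]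
  refine IsClosed.inter (isClosed_iInter fun i => IsClosed.union ?_ (IsClosed.inter ?_ ?_)) ?_
  · exact isClosed_eq (by fun_prop) continuous_const
  · exact isClosed_eq (by fun_prop) continuous_const
  · exact isClosed_eq (Continuous.mul (by fun_prop) (continuous_absRate_comp c _)) continuous_const
  · exact isClosed_eq (by fun_prop) continuous_const

theorem continuous_boxObjective : Continuous (boxObjective (NRT := NRT) c) := by
  have h := continuous_absRate_comp (NRT := NRT) c
  unfold boxObjective
  fun_prop

theorem exists_feasibleRel [Nonempty NRT] (z : QueueState RT NRT × SlotState RT NRT) :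
    ∃ d, (z, d) ∈ feasibleRel c := by
  classical
  obtain ⟨n⟩ := ‹Nonempty NRT›
  have hTs := c.Ts_pos.le
  refine ⟨(fun i => if i = Sum.inr n then ⟨c.Ts, hTs, le_rfl⟩ else ⟨0, le_rfl, hTs⟩,
    fun _ => ⟨0, le_rfl, c.Pmax_pos.le⟩), fun i => Or.inl (by simp), ?_⟩
  rw [Finset.sum_eq_single (Sum.inr n)]
  · simp
  · intro i _ hi; simp [hi]
  · simp

/-- Only the optimal value has to be measurable, jointly in queues and slot, for Fubini; no
measurable selection of an optimal decision is involved. -/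
theorem measurable_slotMax [Nonempty NRT] : Measurable (slotMax (NRT := NRT) c) :=
  measurable_sSup_fiber (isClosed_feasibleRel c) (continuous_boxObjective c) (exists_feasibleRel c)

variable {c}

theorem slotObjective_le_slotMax [Nonempty NRT] {Q : NRT → ℝ} {Y : RT → ℝ} {X : ℝ}
    {a g μ p : RT ⊕ NRT → ℝ} (hg : ∀ i, 0 ≤ g i) (h : SlotFeasible c a g μ p) :
    slotObjective c Q Y X g μ p ≤ slotMax c ((Q, Y, X), fun i => (a i, g i)) := by
  refine (isGreatest_sSup_fiber (isClosed_feasibleRel c) (continuous_boxObjective c)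
    (exists_feasibleRel c) _).2 ⟨(fun i => ⟨μ i, h.duration i⟩, fun i => ⟨p i, h.peak i⟩), ?_, ?_⟩
  · refine ⟨fun i => ?_, h.slot⟩
    simpa only [absRate_eq (h.peak _).1 (hg _)] using h.realTime i
  · simp only [boxObjective, absRate_eq (h.peak _).1 (hg _), slotObjective]

theorem exists_slotObjective_eq_slotMax [Nonempty NRT] {Q : NRT → ℝ} {Y : RT → ℝ} {X : ℝ}
    {a g : RT ⊕ NRT → ℝ} (hg : ∀ i, 0 ≤ g i) :
    ∃ μ p, SlotFeasible c a g μ p ∧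
      slotMax c ((Q, Y, X), fun i => (a i, g i)) = slotObjective c Q Y X g μ p := by
  obtain ⟨⟨d, ⟨h1, h2⟩, hd⟩, -⟩ := isGreatest_sSup_fiber (isClosed_feasibleRel c)
    (continuous_boxObjective c) (exists_feasibleRel c) ((Q, Y, X), fun i => (a i, g i))
  have hp : ∀ i, (0 : ℝ) ≤ d.2 i ∧ (d.2 i : ℝ) ≤ c.Pmax := fun i => (d.2 i).2
  refine ⟨fun i => d.1 i, fun i => d.2 i, ⟨fun i => ?_, hp, fun i => (d.1 i).2, h2⟩, ?_⟩
  · simpa only [absRate_eq (hp _).1 (hg _)] using h1 i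
  · refine hd.symm.trans ?_
    simp only [boxObjective, absRate_eq (hp _).1 (hg _), slotObjective]

theorem LambertStrictSlot.slotObjective_eq [Nonempty NRT] {B : ℝ} {a g : RT ⊕ NRT → ℝ}
    {Q : NRT → ℝ} {Y : RT → ℝ} {X : ℝ} {r : NRT → ℝ} {μ p : RT ⊕ NRT → ℝ}
    (hQ : ∀ i, 0 ≤ Q i) (hX : 0 ≤ X) (hg : ∀ i, 0 ≤ g i)
    (h : LambertStrictSlot c B a g Q Y X r μ p) :
    slotMax c ((Q, Y, X), fun i => (a i, g i)) = slotObjective c Q Y X g μ p := by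
  refine le_antisymm ?_ (slotObjective_le_slotMax hg (h.feasible hQ hX hg))
  obtain ⟨μ', p', h', e⟩ := exists_slotObjective_eq_slotMax (c := c) (Q := Q) (Y := Y) (X := X)
    (a := a) hg
  rw [e]
  exact h.optimal hQ hX hg h'

end SlotMax

/-! ### Queue dynamics -/

section Dynamics

variable {RT NRT : Type*} [Fintype RT] [Fintype NRT] {c : Cell RT} {s : Scenario c NRT}
  {Ω : Type*} [MeasurableSpace Ω] {P : Measure Ω} {d : Network s P} {π : Policy d}

variable (π) in
/-- The constraints of the problem that concern a single slot. -/
structure Policy.SlotAdmissible : Prop where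
  admission : ∀ k i ω, (π.r k i ω = 0 ∨ π.r k i ω = 1) ∧ π.r k i ω ≤ d.arr k (Sum.inr i) ω
  slot : ∀ k ω, SlotFeasible c (fun i => d.arr k i ω) (fun i => d.gain k i ω)
    (fun i => π.μ k i ω) (fun i => π.p k i ω)

theorem Policy.Admissible.slotAdmissible (h : π.Admissible) : π.SlotAdmissible where
  admission := h.admission
  slot k ω := ⟨fun i => h.realTime k i ω, fun i => h.peak k i ω, fun i => h.duration k i ω,
    h.slot k ω⟩

theorem Policy.Q_nonneg (π : Policy d) (k : ℕ) (i : NRT) (ω : Ω) : 0 ≤ π.Q k i ω := by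
  cases k with
  | zero => exact s.Q₀_nonneg i
  | succ k => exact le_max_right _ _

theorem Policy.Y_nonneg (π : Policy d) (k : ℕ) (i : RT) (ω : Ω) : 0 ≤ π.Y k i ω := by
  cases k with
  | zero => exact le_rfl
  | succ k => exact le_max_right _ _

theorem Policy.X_nonneg (π : Policy d) (k : ℕ) (ω : Ω) : 0 ≤ π.X k ω := by
  cases k with
  | zero => exact le_rfl
  | succ k => exact le_max_right _ _

/-- Conservation of bits in the buffer. Summed over time, it turns throughput into admissions minus
a telescoping queue difference. -/
theorem Policy.sent_eq (π : Policy d) (k : ℕ) (i : NRT) (ω : Ω) :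
    π.sent k i ω = c.L * π.r k i ω - (π.Q (k + 1) i ω - π.Q k i ω) := by
  simp only [Policy.sent, Policy.Q]
  rcases le_total (π.service k (Sum.inr i) ω) (π.Q k i ω + c.L * π.r k i ω) with h | h
  · rw [min_eq_left h, max_eq_left (by linarith)]; ring
  · rw [min_eq_right h, max_eq_right (by linarith)]; ring

theorem Network.arr_mem_Icc (d : Network s P) (k : ℕ) (i : RT ⊕ NRT) (ω : Ω) :
    0 ≤ d.arr k i ω ∧ d.arr k i ω ≤ 1 := by
  rcases d.arr_mem k i ω with h | h <;> rw [h] <;> norm_num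

theorem Policy.IsLambertStrict.slotAdmissible {B : ℝ} (h : π.IsLambertStrict B) :
    π.SlotAdmissible where
  admission k i ω := by
    have h1 : (π.Q k i ω < B → π.r k i ω = d.arr k (Sum.inr i) ω) ∧
      (B ≤ π.Q k i ω → π.r k i ω = 0) := (h k ω).1 i
    rcases lt_or_ge (π.Q k i ω) B with hB | hB
    · rw [h1.1 hB]; exact ⟨d.arr_mem _ _ _, le_rfl⟩
    · rw [h1.2 hB]; exact ⟨Or.inl rfl, (d.arr_mem_Icc _ _ _).1⟩
  slot k ω := (h k ω).feasible (fun i => π.Q_nonneg k i ω) (π.X_nonneg k ω)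
    fun i => (d.gain_mem k i ω).1

variable (c) in
/-- The largest possible number of bits of service in a slot. -/
noncomputable def maxService : ℝ := c.Ts * rate c.Pmax c.gmax

variable (c) in
omit [Fintype RT] in
theorem maxService_nonneg : 0 ≤ maxService c :=
  mul_nonneg c.Ts_pos.le (rate_nonneg c.Pmax_pos.le c.gmax_nonneg)

namespace Policy.SlotAdmissible

variable (h : π.SlotAdmissible)
include h

theorem r_mem (k : ℕ) (i : NRT) (ω : Ω) : 0 ≤ π.r k i ω ∧ π.r k i ω ≤ 1 := by
  rcases (h.admission k i ω).1 with h | h <;> rw [h] <;> norm_num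

theorem service_mem (k : ℕ) (i : RT ⊕ NRT) (ω : Ω) :
    0 ≤ π.service k i ω ∧ π.service k i ω ≤ maxService c := by
  obtain ⟨hp0, hp1⟩ := (h.slot k ω).peak i
  obtain ⟨hμ0, hμ1⟩ := (h.slot k ω).duration i
  obtain ⟨hg0, hg1⟩ := d.gain_mem k i ω
  have hr := rate_nonneg hp0 hg0
  exact ⟨mul_nonneg hμ0 hr,
    mul_le_mul hμ1 (rate_mono hp0 hg0 hp1 hg1) hr c.Ts_pos.le⟩

theorem power_mem (k : ℕ) (ω : Ω) : 0 ≤ π.power k ω ∧ π.power k ω ≤ c.Pmax := by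
  have hs := h.slot k ω
  unfold Policy.power
  refine ⟨div_nonneg (Finset.sum_nonneg fun i _ => mul_nonneg (hs.peak i).1 (hs.duration i).1)
    c.Ts_pos.le, ?_⟩
  rw [div_le_iff₀ c.Ts_pos, ← hs.slot, Finset.mul_sum]
  exact Finset.sum_le_sum fun i _ => mul_le_mul_of_nonneg_right (hs.peak i).2 (hs.duration i).1

/-- A real-time user that is given time sends exactly one packet, so the indicator in the recursion
of `Y` is the service in packets. -/
theorem served_eq (k : ℕ) (i : RT) (ω : Ω) [Decidable (π.μ k (Sum.inl i) ω ≠ 0)] :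
    (if π.μ k (Sum.inl i) ω ≠ 0 then (1 : ℝ) else 0) = π.service k (Sum.inl i) ω / c.L := by
  by_cases h0 : π.μ k (Sum.inl i) ω = 0
  · simp [Policy.service, h0]
  · have := (((h.slot k ω).realTime i).resolve_left h0).2
    simp only [Policy.service, ne_eq, h0, not_false_eq_true, if_true]
    rw [this, div_self c.L_pos.ne']

theorem service_div_mem (k : ℕ) (i : RT) (ω : Ω) :
    0 ≤ π.service k (Sum.inl i) ω / c.L ∧ π.service k (Sum.inl i) ω / c.L ≤ 1 := by
  classical
  rw [← h.served_eq]
  split_ifs <;> norm_num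

theorem Y_succ (k : ℕ) (i : RT) (ω : Ω) : π.Y (k + 1) i ω =
    max (π.Y k i ω + d.arr k (Sum.inl i) ω * c.q i - π.service k (Sum.inl i) ω / c.L) 0 := by
  rw [Policy.Y, h.served_eq]

/-- This and the next two crude growth bounds serve to make the queues and their squares integrable
in each slot. -/
theorem Q_le (k : ℕ) (i : NRT) (ω : Ω) : π.Q k i ω ≤ s.Q₀ i + c.L * k := by
  induction k with
  | zero => simp [Policy.Q]
  | succ k ih =>
    have h1 := (h.service_mem k (Sum.inr i) ω).1
    have h2 := (h.r_mem k i ω).2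
    have hL := c.L_pos
    have h0 := s.Q₀_nonneg i
    push_cast
    exact max_le (by nlinarith) (by positivity)

theorem Y_le (k : ℕ) (i : RT) (ω : Ω) : π.Y k i ω ≤ k := by
  induction k with
  | zero => simp [Policy.Y]
  | succ k ih =>
    rw [h.Y_succ]
    have h1 := (h.service_div_mem k i ω).1
    obtain ⟨ha, ha'⟩ := d.arr_mem_Icc k (Sum.inl i) ω
    obtain ⟨hq, hq'⟩ := c.q_mem i
    push_cast
    exact max_le (by nlinarith) (by positivity)

theorem X_le (k : ℕ) (ω : Ω) : π.X k ω ≤ c.Pmax * k := by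
  induction k with
  | zero => simp [Policy.X]
  | succ k ih =>
    have h1 := (h.power_mem k ω).2
    have hP := c.Pmax_pos
    have hP' := c.Pavg_pos
    push_cast
    exact max_le (by linarith) (by positivity)

end Policy.SlotAdmissible

/-! #### Measurability and integrability -/

theorem Policy.service_meas (π : Policy d) (k : ℕ) (i : RT ⊕ NRT) :
    Measurable[d.hist (k + 1)] (π.service k i) := by
  have h1 := π.μ_meas k i
  have h2 := π.p_meas k i
  have h3 := d.gain_meas k i
  unfold Policy.service rate
  exact h1.mul (Real.measurable_log.comp ((h2.mul h3).const_add 1))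

theorem Policy.power_meas (π : Policy d) (k : ℕ) : Measurable[d.hist (k + 1)] (π.power k) := by
  unfold Policy.power
  exact (Finset.measurable_fun_sum _ fun i _ => (π.p_meas k i).mul (π.μ_meas k i)).div_const _

theorem Policy.Q_meas (π : Policy d) (k : ℕ) (i : NRT) : Measurable[d.hist k] (π.Q k i) := by
  induction k with
  | zero => exact measurable_const
  | succ k ih =>
    have h1 := ih.mono (d.hist.mono k.le_succ) le_rfl
    exact ((h1.add ((π.r_meas k i).const_mul _)).sub (π.service_meas k _)).max measurable_const

theorem Policy.X_meas (π : Policy d) (k : ℕ) : Measurable[d.hist k] (π.X k) := by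
  induction k with
  | zero => exact measurable_const
  | succ k ih =>
    have h1 := ih.mono (d.hist.mono k.le_succ) le_rfl
    exact ((h1.add (π.power_meas k)).sub measurable_const).max measurable_const

theorem Policy.SlotAdmissible.Y_meas (h : π.SlotAdmissible) (k : ℕ) (i : RT) :
    Measurable[d.hist k] (π.Y k i) := by
  induction k with
  | zero => exact measurable_const
  | succ k ih =>
    have h1 := ih.mono (d.hist.mono k.le_succ) le_rfl
    have e : π.Y (k + 1) i = fun ω => max (π.Y k i ω + d.arr k (Sum.inl i) ω * c.q i
        - π.service k (Sum.inl i) ω / c.L) 0 := funext fun ω => h.Y_succ k i ω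
    rw [e]
    exact ((h1.add ((d.arr_meas k _).mul_const _)).sub
      ((π.service_meas k _).div_const _)).max measurable_const

variable [IsProbabilityMeasure P]

omit [Fintype RT] [Fintype NRT] in
theorem integrable_of_mem_Icc {f : Ω → ℝ} {a b : ℝ} (hf : Measurable f)
    (h : ∀ ω, a ≤ f ω ∧ f ω ≤ b) : Integrable f P :=
  Integrable.of_mem_Icc a b hf.aemeasurable (ae_of_all _ h)

omit [Fintype RT] [Fintype NRT] in
theorem integrable_sq_of_mem_Icc {f : Ω → ℝ} {b : ℝ} (hf : Measurable f)
    (h : ∀ ω, 0 ≤ f ω ∧ f ω ≤ b) : Integrable (fun ω => f ω ^ 2) P :=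
  integrable_of_mem_Icc (hf.pow_const 2)
    fun ω => ⟨sq_nonneg _, pow_le_pow_left₀ (h ω).1 (h ω).2 2⟩

theorem Network.integrable_arr (d : Network s P) (k : ℕ) (i : RT ⊕ NRT) :
    Integrable (d.arr k i) P :=
  integrable_of_mem_Icc ((d.arr_meas k i).mono (d.hist.le _) le_rfl) fun ω => d.arr_mem_Icc k i ω

namespace Policy.SlotAdmissible

variable (h : π.SlotAdmissible)
include h

theorem integrable_r (k : ℕ) (i : NRT) : Integrable (π.r k i) P :=
  integrable_of_mem_Icc ((π.r_meas k i).mono (d.hist.le _) le_rfl) fun ω => h.r_mem k i ω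

theorem integrable_service (k : ℕ) (i : RT ⊕ NRT) : Integrable (π.service k i) P :=
  integrable_of_mem_Icc ((π.service_meas k i).mono (d.hist.le _) le_rfl)
    fun ω => h.service_mem k i ω

theorem integrable_power (k : ℕ) : Integrable (π.power k) P :=
  integrable_of_mem_Icc ((π.power_meas k).mono (d.hist.le _) le_rfl) fun ω => h.power_mem k ω

theorem integrable_Q (k : ℕ) (i : NRT) : Integrable (π.Q k i) P :=
  integrable_of_mem_Icc ((π.Q_meas k i).mono (d.hist.le _) le_rfl)
    fun ω => ⟨π.Q_nonneg k i ω, h.Q_le k i ω⟩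

theorem integrable_Y (k : ℕ) (i : RT) : Integrable (π.Y k i) P :=
  integrable_of_mem_Icc ((h.Y_meas k i).mono (d.hist.le _) le_rfl)
    fun ω => ⟨π.Y_nonneg k i ω, h.Y_le k i ω⟩

theorem integrable_X (k : ℕ) : Integrable (π.X k) P :=
  integrable_of_mem_Icc ((π.X_meas k).mono (d.hist.le _) le_rfl)
    fun ω => ⟨π.X_nonneg k ω, h.X_le k ω⟩

theorem integrable_Q_sq (k : ℕ) (i : NRT) : Integrable (fun ω => π.Q k i ω ^ 2) P :=
  integrable_sq_of_mem_Icc ((π.Q_meas k i).mono (d.hist.le _) le_rfl)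
    fun ω => ⟨π.Q_nonneg k i ω, h.Q_le k i ω⟩

theorem integrable_Y_sq (k : ℕ) (i : RT) : Integrable (fun ω => π.Y k i ω ^ 2) P :=
  integrable_sq_of_mem_Icc ((h.Y_meas k i).mono (d.hist.le _) le_rfl)
    fun ω => ⟨π.Y_nonneg k i ω, h.Y_le k i ω⟩

theorem integrable_X_sq (k : ℕ) : Integrable (fun ω => π.X k ω ^ 2) P :=
  integrable_sq_of_mem_Icc ((π.X_meas k).mono (d.hist.le _) le_rfl)
    fun ω => ⟨π.X_nonneg k ω, h.X_le k ω⟩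

theorem integrable_sent (k : ℕ) (i : NRT) : Integrable (π.sent k i) P := by
  rw [show π.sent k i = fun ω => c.L * π.r k i ω - (π.Q (k + 1) i ω - π.Q k i ω) from
    funext fun ω => π.sent_eq k i ω]
  exact ((h.integrable_r k i).const_mul _).sub ((h.integrable_Q _ i).sub (h.integrable_Q _ i))

theorem integral_sent (k : ℕ) (i : NRT) : ∫ ω, π.sent k i ω ∂P =
    c.L * ∫ ω, π.r k i ω ∂P - (∫ ω, π.Q (k + 1) i ω ∂P - ∫ ω, π.Q k i ω ∂P) := by
  simp only [π.sent_eq]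
  rw [integral_sub (g := fun ω => π.Q (k + 1) i ω - π.Q k i ω) ((h.integrable_r k i).const_mul _)
    ((h.integrable_Q _ i).sub (h.integrable_Q _ i)), integral_const_mul,
    integral_sub (h.integrable_Q _ i) (h.integrable_Q _ i)]

end Policy.SlotAdmissible

/-! #### The distribution of a slot -/

omit [IsProbabilityMeasure P] in
theorem Network.measurable_slot (d : Network s P) (k : ℕ) :
    Measurable fun ω (i : RT ⊕ NRT) => (d.arr k i ω, d.gain k i ω) :=
  measurable_pi_lambda _ fun i => ((d.arr_meas k i).mono (d.hist.le _) le_rfl).prodMk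
    ((d.gain_meas k i).mono (d.hist.le _) le_rfl)

omit [Fintype RT] [Fintype NRT] in
theorem isProbabilityMeasure_bernoulliLaw {p : ℝ} (hp : p ∈ Set.Icc (0 : ℝ) 1) :
    IsProbabilityMeasure (bernoulliLaw p) := by
  constructor
  simp only [bernoulliLaw, Measure.add_apply, Measure.smul_apply, measure_univ, smul_eq_mul,
    mul_one]
  rw [← ENNReal.ofReal_add hp.1 (by linarith [hp.2])]
  simp

omit [Fintype RT] [Fintype NRT] in
theorem integral_bernoulliLaw {p : ℝ} (hp : p ∈ Set.Icc (0 : ℝ) 1) :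
    ∫ x, x ∂bernoulliLaw p = p := by
  have hi : ∀ a : ℝ, Integrable (fun x : ℝ => x) (Measure.dirac a) := fun a =>
    integrable_dirac (by simp)
  unfold bernoulliLaw
  rw [integral_add_measure ((hi 1).smul_measure ENNReal.ofReal_ne_top)
    ((hi 0).smul_measure ENNReal.ofReal_ne_top), integral_smul_measure, integral_smul_measure,
    integral_dirac, integral_dirac, ENNReal.toReal_ofReal hp.1]
  simp

omit [IsProbabilityMeasure P] in
theorem Network.integral_arr (d : Network s P) (k : ℕ) (i : RT ⊕ NRT) :
    ∫ ω, d.arr k i ω ∂P = s.lam i := by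
  have := s.gainLaw_prob
  have := fun i => isProbabilityMeasure_bernoulliLaw (s.lam_mem i)
  have h1 : ∫ ω, d.arr k i ω ∂P
      = ∫ x, (x i).1 ∂(P.map fun ω i => (d.arr k i ω, d.gain k i ω)) := by
    rw [integral_map (d.measurable_slot k).aemeasurable
      (by fun_prop : Measurable fun x : RT ⊕ NRT → ℝ × ℝ => (x i).1).aestronglyMeasurable]
  rw [h1, d.law]
  have h2 : (s.slotLaw.map fun x => (x i).1) = bernoulliLaw (s.lam i) := by
    have e1 := (measurePreserving_eval
      (fun i => (bernoulliLaw (s.lam i)).prod (s.gainLaw i)) i)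
    have e2 := (measurePreserving_fst (μ := bernoulliLaw (s.lam i)) (ν := s.gainLaw i)).comp e1
    exact e2.map_eq
  rw [← integral_bernoulliLaw (s.lam_mem i), ← h2]
  exact (integral_map (f := fun y : ℝ => y)
    (by fun_prop : Measurable fun x : RT ⊕ NRT → ℝ × ℝ => (x i).1).aemeasurable
    aestronglyMeasurable_id).symm

end Dynamics

section Reward

variable {RT NRT : Type*} [Fintype RT] [Fintype NRT] {c : Cell RT} {s : Scenario c NRT}

/-! ### The reward of a slot -/

variable (c) in
/-- The optimal value of drift and penalty in a slot, as a function of the queues. -/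
noncomputable def reward (B : ℝ) (z : QueueState RT NRT × SlotState RT NRT) : ℝ :=
  slotMax c z + ∑ n, c.L * max (B - z.1.1 n) 0 * (z.2 (Sum.inr n)).1
    - ∑ i, z.1.2.1 i * ((z.2 (Sum.inl i)).1 * c.q i) + z.1.2.2 * c.Pavg

theorem measurable_reward [Nonempty NRT] (B : ℝ) : Measurable (reward (NRT := NRT) c B) := by
  have := measurable_slotMax (NRT := NRT) c
  unfold reward
  fun_prop

theorem slotMax_nonneg [Nonempty NRT] {Q : NRT → ℝ} {Y : RT → ℝ} {X : ℝ}
    {a g : RT ⊕ NRT → ℝ} (hg : ∀ i, 0 ≤ g i) :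
    0 ≤ slotMax c ((Q, Y, X), fun i => (a i, g i)) := by
  classical
  obtain ⟨n⟩ := ‹Nonempty NRT›
  have h := slotObjective_le_slotMax (c := c) (Q := Q) (Y := Y) (X := X) (a := a)
    (μ := Pi.single (Sum.inr n) c.Ts) (p := 0) hg ⟨fun i => Or.inl (by simp),
      fun i => ⟨le_rfl, c.Pmax_pos.le⟩, fun i => ?_, by simp⟩
  · simpa [slotObjective, rate] using h
  · by_cases hi : i = Sum.inr n
    · subst hi; simp [c.Ts_pos.le]
    · simp [hi, c.Ts_pos.le]

theorem slotMax_le [Nonempty NRT] {Q : NRT → ℝ} {Y : RT → ℝ} {X : ℝ}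
    {a g : RT ⊕ NRT → ℝ} (hQ : ∀ i, 0 ≤ Q i) (hY : ∀ i, 0 ≤ Y i) (hX : 0 ≤ X)
    (hg : ∀ i, 0 ≤ g i ∧ g i ≤ c.gmax) :
    slotMax c ((Q, Y, X), fun i => (a i, g i)) ≤ ∑ i, Y i + ∑ n, Q n * maxService c := by
  obtain ⟨μ, p, h, e⟩ := exists_slotObjective_eq_slotMax (c := c) (Q := Q) (Y := Y) (X := X)
    (a := a) fun i => (hg i).1
  have hL := c.L_pos
  rw [e]
  unfold slotObjective
  have h1 : ∑ i, Y i * (μ (Sum.inl i) * rate (p (Sum.inl i)) (g (Sum.inl i)) / c.L)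
      ≤ ∑ i, Y i := Finset.sum_le_sum fun i _ => by
    refine mul_le_of_le_one_right (hY i) ?_
    rcases h.realTime i with h0 | h0
    · rw [h0]; simp
    · rw [h0.2, div_self hL.ne']
  have h2 : ∑ n, Q n * (μ (Sum.inr n) * rate (p (Sum.inr n)) (g (Sum.inr n)))
      ≤ ∑ n, Q n * maxService c := Finset.sum_le_sum fun n _ => by
    obtain ⟨hp0, hp1⟩ := h.peak (Sum.inr n)
    obtain ⟨hμ0, hμ1⟩ := h.duration (Sum.inr n)
    obtain ⟨hg0, hg1⟩ := hg (Sum.inr n)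
    exact mul_le_mul_of_nonneg_left (mul_le_mul hμ1 (rate_mono hp0 hg0 hp1 hg1)
      (rate_nonneg hp0 hg0) c.Ts_pos.le) (hQ n)
  have h3 : 0 ≤ X * ((∑ i, p i * μ i) / c.Ts) := mul_nonneg hX (div_nonneg
    (Finset.sum_nonneg fun i _ => mul_nonneg (h.peak i).1 (h.duration i).1) c.Ts_pos.le)
  linarith

theorem abs_reward_le [Nonempty NRT] {B : ℝ} (hB : 0 < B) {Q : NRT → ℝ} {Y : RT → ℝ} {X : ℝ}
    {a g : RT ⊕ NRT → ℝ} (hQ : ∀ i, 0 ≤ Q i) (hY : ∀ i, 0 ≤ Y i) (hX : 0 ≤ X)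
    (hg : ∀ i, 0 ≤ g i ∧ g i ≤ c.gmax) (ha : ∀ i, 0 ≤ a i ∧ a i ≤ 1) :
    |reward c B ((Q, Y, X), fun i => (a i, g i))|
      ≤ ∑ i, Y i + ∑ n, Q n * maxService c + ∑ _n : NRT, c.L * B + X * c.Pavg := by
  have hL := c.L_pos
  have h0 := slotMax_nonneg (c := c) (Q := Q) (Y := Y) (X := X) (a := a) fun i => (hg i).1
  have h1 := slotMax_le (a := a) hQ hY hX hg
  have h2 : 0 ≤ ∑ n, c.L * max (B - Q n) 0 * a (Sum.inr n) := Finset.sum_nonneg fun n _ =>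
    mul_nonneg (mul_nonneg hL.le (le_max_right _ _)) (ha _).1
  have h3 : ∑ n, c.L * max (B - Q n) 0 * a (Sum.inr n) ≤ ∑ _n : NRT, c.L * B :=
    Finset.sum_le_sum fun n _ => by
      refine (mul_le_of_le_one_right (mul_nonneg hL.le (le_max_right _ _)) (ha _).2).trans ?_
      exact mul_le_mul_of_nonneg_left (max_le (by linarith [hQ n]) hB.le) hL.le
  have h4 : 0 ≤ ∑ i, Y i * (a (Sum.inl i) * c.q i) := Finset.sum_nonneg fun i _ =>
    mul_nonneg (hY i) (mul_nonneg (ha _).1 (c.q_mem i).1)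
  have h5 : ∑ i, Y i * (a (Sum.inl i) * c.q i) ≤ ∑ i, Y i := Finset.sum_le_sum fun i _ =>
    mul_le_of_le_one_right (hY i) (mul_le_one₀ (ha _).2 (c.q_mem i).1 (c.q_mem i).2)
  have h6 : 0 ≤ X * c.Pavg := mul_nonneg hX c.Pavg_pos.le
  have h7 : 0 ≤ ∑ n, Q n * maxService c := Finset.sum_nonneg fun n _ =>
    mul_nonneg (hQ n) (maxService_nonneg c)
  unfold reward
  simp only
  rw [abs_le]
  constructor <;> linarith

/-! ### The reward earned by a policy -/

variable {Ω : Type*} [MeasurableSpace Ω] {P : Measure Ω} {d : Network s P} {π : Policy d}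

/-- The arrivals and gains of slot `k`. -/
def Network.slot (d : Network s P) (k : ℕ) (ω : Ω) : SlotState RT NRT :=
  fun i => (d.arr k i ω, d.gain k i ω)

/-- The reward that a policy earns in slot `k` when the queues are weighted by `θ`. -/
noncomputable def Policy.earned (π : Policy d) (B : ℝ) (θ : QueueState RT NRT) (k : ℕ) (ω : Ω) :
    ℝ :=
  ∑ i, θ.2.1 i * (π.service k (Sum.inl i) ω / c.L - d.arr k (Sum.inl i) ω * c.q i)
    + ∑ n, (θ.1 n * (π.service k (Sum.inr n) ω - c.L * π.r k n ω) + B * c.L * π.r k n ω)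
    + θ.2.2 * (c.Pavg - π.power k ω)

/-- The admission terms combine to `L * (B - θ) * r`, which explains the threshold `B`: admitting
pays exactly when the weight is below `B`. -/
theorem Policy.earned_eq (π : Policy d) (B : ℝ) (θ : QueueState RT NRT) (k : ℕ) (ω : Ω) :
    π.earned B θ k ω = slotObjective c θ.1 θ.2.1 θ.2.2 (fun i => d.gain k i ω)
        (fun i => π.μ k i ω) (fun i => π.p k i ω) + ∑ n, c.L * ((B - θ.1 n) * π.r k n ω)
      - ∑ i, θ.2.1 i * (d.arr k (Sum.inl i) ω * c.q i) + θ.2.2 * c.Pavg := by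
  have e : ∑ n, (θ.1 n * (π.service k (Sum.inr n) ω - c.L * π.r k n ω) + B * c.L * π.r k n ω)
      = ∑ n, θ.1 n * π.service k (Sum.inr n) ω + ∑ n, c.L * ((B - θ.1 n) * π.r k n ω) := by
    rw [← Finset.sum_add_distrib]
    exact Finset.sum_congr rfl fun n _ => by ring
  unfold earned
  rw [e]
  simp only [mul_sub, Finset.sum_sub_distrib]
  unfold slotObjective Policy.service Policy.power
  ring

variable [Nonempty NRT]

/-- The weights need not be the policy's own queues. This lets a competitor be measured against the
queues of the algorithm. -/
theorem Policy.SlotAdmissible.earned_le (h : π.SlotAdmissible) (B : ℝ) (θ : QueueState RT NRT)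
    (k : ℕ) (ω : Ω) : π.earned B θ k ω ≤ reward c B (θ, d.slot k ω) := by
  rw [π.earned_eq]
  unfold reward
  have h1 := slotObjective_le_slotMax (Q := θ.1) (Y := θ.2.1) (X := θ.2.2)
    (fun i => (d.gain_mem k i ω).1) (h.slot k ω)
  have h2 : ∑ n, c.L * ((B - θ.1 n) * π.r k n ω)
      ≤ ∑ n, c.L * max (B - θ.1 n) 0 * (d.slot k ω (Sum.inr n)).1 := by
    refine Finset.sum_le_sum fun n _ => ?_
    rw [mul_assoc]
    refine mul_le_mul_of_nonneg_left ?_ c.L_pos.le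
    have hr := h.r_mem k n ω
    exact mul_le_mul (le_max_left _ _) (h.admission k n ω).2 hr.1 (le_max_right _ _)
  change _ ≤ slotMax c ((θ.1, θ.2.1, θ.2.2), fun i => (d.arr k i ω, d.gain k i ω)) + _ - _ + _
  have h3 : ∑ i, θ.2.1 i * ((d.slot k ω (Sum.inl i)).1 * c.q i)
      = ∑ i, θ.2.1 i * (d.arr k (Sum.inl i) ω * c.q i) := rfl
  rw [h3]
  linarith

/-- The queues of a policy before slot `k`. -/
noncomputable def Policy.state (π : Policy d) (k : ℕ) (ω : Ω) : QueueState RT NRT :=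
  (fun i => π.Q k i ω, fun i => π.Y k i ω, π.X k ω)

theorem Policy.IsLambertStrict.earned_eq {B : ℝ} (h : π.IsLambertStrict B) (k : ℕ) (ω : Ω) :
    π.earned B (π.state k ω) k ω = reward c B (π.state k ω, d.slot k ω) := by
  rw [π.earned_eq]
  unfold reward
  have h1 := (h k ω).slotObjective_eq (fun i => π.Q_nonneg k i ω) (π.X_nonneg k ω)
    fun i => (d.gain_mem k i ω).1
  have h2 : ∑ n, c.L * ((B - (π.state k ω).1 n) * π.r k n ω)
      = ∑ n, c.L * max (B - (π.state k ω).1 n) 0 * (d.slot k ω (Sum.inr n)).1 := by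
    refine Finset.sum_congr rfl fun n _ => ?_
    have hr : (π.Q k n ω < B → π.r k n ω = d.arr k (Sum.inr n) ω) ∧
      (B ≤ π.Q k n ω → π.r k n ω = 0) := (h k ω).1 n
    change c.L * ((B - π.Q k n ω) * π.r k n ω)
      = c.L * max (B - π.Q k n ω) 0 * d.arr k (Sum.inr n) ω
    rcases lt_or_ge (π.Q k n ω) B with hB | hB
    · rw [hr.1 hB, max_eq_left (by linarith)]; ring
    · rw [hr.2 hB, max_eq_right (by linarith)]; ring
  rw [h2]
  change slotObjective c (fun i => π.Q k i ω) (fun i => π.Y k i ω) (π.X k ω) _ _ _ + _ - _ + _ = _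
  rw [← h1]
  rfl

variable [IsProbabilityMeasure P]

-- The right-hand side depends only on the scenario. It links a competitor and the algorithm, which
-- live on different probability spaces.
omit [IsProbabilityMeasure P] in
theorem integral_reward_slot (d : Network s P) (B : ℝ) (θ : QueueState RT NRT) (k : ℕ) :
    ∫ ω, reward c B (θ, d.slot k ω) ∂P = ∫ x, reward c B (θ, x) ∂s.slotLaw := by
  rw [← d.law k]
  exact (integral_map (d.measurable_slot k).aemeasurable
    ((measurable_reward B).comp measurable_prodMk_left).aestronglyMeasurable).symm

omit [Nonempty NRT] [IsProbabilityMeasure P] in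
theorem Network.measurable_slot' (d : Network s P) (k : ℕ) : Measurable (d.slot k) :=
  d.measurable_slot k

theorem integrable_reward_slot (d : Network s P) {B : ℝ} (hB : 0 < B) {θ : QueueState RT NRT}
    (hQ : ∀ n, 0 ≤ θ.1 n) (hY : ∀ i, 0 ≤ θ.2.1 i) (hX : 0 ≤ θ.2.2) (k : ℕ) :
    Integrable (fun ω => reward c B (θ, d.slot k ω)) P := by
  refine Integrable.mono' (integrable_const (∑ i, θ.2.1 i + ∑ n, θ.1 n * maxService c
    + ∑ _n : NRT, c.L * B + θ.2.2 * c.Pavg)) ?_ (ae_of_all _ fun ω => ?_)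
  · exact ((measurable_reward B).comp
      (measurable_const.prodMk (d.measurable_slot' k))).aestronglyMeasurable
  · exact abs_reward_le hB hQ hY hX (fun i => d.gain_mem k i ω) fun i => d.arr_mem_Icc k i ω

omit [Nonempty NRT] [IsProbabilityMeasure P] in
theorem Policy.SlotAdmissible.measurable_state (h : π.SlotAdmissible) (k : ℕ) :
    Measurable[d.hist k] (π.state k) := by
  have hQ : Measurable[d.hist k] fun ω i => π.Q k i ω :=
    @measurable_pi_lambda _ _ _ (d.hist k) _ _ fun i => π.Q_meas k i
  have hY : Measurable[d.hist k] fun ω i => π.Y k i ω :=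
    @measurable_pi_lambda _ _ _ (d.hist k) _ _ fun i => h.Y_meas k i
  exact hQ.prodMk (hY.prodMk (π.X_meas k))

theorem Policy.SlotAdmissible.integrable_reward (h : π.SlotAdmissible) {B : ℝ} (hB : 0 < B)
    (k : ℕ) : Integrable (fun ω => reward c B (π.state k ω, d.slot k ω)) P := by
  refine Integrable.mono' (g := fun ω => ∑ i, π.Y k i ω + ∑ n, π.Q k n ω * maxService c
    + ∑ _n : NRT, c.L * B + π.X k ω * c.Pavg) ?_ ?_ (ae_of_all _ fun ω => ?_)
  · exact (((integrable_finsetSum _ fun i _ => h.integrable_Y k i).add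
      (integrable_finsetSum _ fun n _ => (h.integrable_Q k n).mul_const _)).add
      (integrable_const _)).add ((h.integrable_X k).mul_const _)
  · exact ((measurable_reward B).comp (((h.measurable_state k).mono (d.hist.le k) le_rfl).prodMk
      (d.measurable_slot' k))).aestronglyMeasurable
  · exact abs_reward_le hB (fun n => π.Q_nonneg k n ω) (fun i => π.Y_nonneg k i ω)
      (π.X_nonneg k ω) (fun i => d.gain_mem k i ω) fun i => d.arr_mem_Icc k i ω

/-- The state is independent of the arrivals and gains of the slot. -/
theorem Policy.SlotAdmissible.le_integral_reward (h : π.SlotAdmissible) {B b : ℝ} (hB : 0 < B)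
    (hb : ∀ θ : QueueState RT NRT, (∀ n, 0 ≤ θ.1 n) → (∀ i, 0 ≤ θ.2.1 i) → 0 ≤ θ.2.2 →
      b ≤ ∫ x, reward c B (θ, x) ∂s.slotLaw) (k : ℕ) :
    b ≤ ∫ ω, reward c B (π.state k ω, d.slot k ω) ∂P := by
  have hm := (h.measurable_state k).mono (d.hist.le k) le_rfl
  have hs := d.measurable_slot' k
  -- The queues before slot `k` are `hist k`-measurable, so their joint law with the slot is a
  -- product. By Fubini, the bound for each fixed `θ` can be integrated over the law of the state.
  have hind : IndepFun (π.state k) (d.slot k) P := by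
    rw [IndepFun_iff_Indep]
    exact (indep_of_indep_of_le_right (d.indep k) (h.measurable_state k).comap_le).symm
  have hlaw := (indepFun_iff_map_prod_eq_prod_map_map hm.aemeasurable hs.aemeasurable).1 hind
  have hslot : P.map (d.slot k) = s.slotLaw := d.law k
  rw [hslot] at hlaw
  have : IsProbabilityMeasure (P.map (π.state k)) := Measure.isProbabilityMeasure_map hm.aemeasurable
  have : IsProbabilityMeasure s.slotLaw := by
    rw [← hslot]; exact Measure.isProbabilityMeasure_map hs.aemeasurable
  have hR := measurable_reward (c := c) (NRT := NRT) B
  have hint : Integrable (reward c B) ((P.map (π.state k)).prod s.slotLaw) := by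
    rw [← hlaw, integrable_map_measure hR.aestronglyMeasurable (hm.prodMk hs).aemeasurable]
    exact h.integrable_reward hB k
  have e : ∫ ω, reward c B (π.state k ω, d.slot k ω) ∂P
      = ∫ θ, ∫ x, reward c B (θ, x) ∂s.slotLaw ∂(P.map (π.state k)) := by
    rw [← integral_prod _ hint, ← hlaw,
      integral_map (hm.prodMk hs).aemeasurable hR.aestronglyMeasurable]
  have hint2 := hint.integral_prod_left
  rw [e, integral_map hm.aemeasurable hint2.aestronglyMeasurable]
  have hint3 := (integrable_map_measure hint2.aestronglyMeasurable hm.aemeasurable).1 hint2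
  calc b = ∫ _ω, b ∂P := by simp
    _ ≤ _ := integral_mono (integrable_const b) hint3 fun ω =>
      hb _ (fun n => π.Q_nonneg k n ω) (fun i => π.Y_nonneg k i ω) (π.X_nonneg k ω)

end Reward

/-! ### Time averages -/

/-- The uniform bound supplies the coboundedness on which a real `liminf` depends. -/
theorem le_liminf_of_sub_le {u e : ℕ → ℝ} {a b : ℝ} (hb : ∀ K, u K ≤ b)
    (h : ∀ᶠ K in atTop, a - e K ≤ u K) (he : Tendsto e atTop (nhds 0)) :
    a ≤ liminf u atTop := by
  refine le_of_forall_pos_le_add fun ε hε => ?_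
  have h1 : ∀ᶠ K in atTop, a - ε ≤ u K := by
    filter_upwards [h, he.eventually_lt_const hε] with K h2 h3
    linarith
  have h2 : a - ε ≤ liminf u atTop :=
    le_liminf_of_le (isBoundedUnder_of ⟨b, hb⟩).isCoboundedUnder_ge h1
  linarith

theorem limsup_le_of_le_add {u e : ℕ → ℝ} {a b : ℝ} (hb : ∀ K, b ≤ u K)
    (h : ∀ᶠ K in atTop, u K ≤ a + e K) (he : Tendsto e atTop (nhds 0)) :
    limsup u atTop ≤ a := by
  refine le_of_forall_pos_le_add fun ε hε => ?_
  have h1 : ∀ᶠ K in atTop, u K ≤ a + ε := by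
    filter_upwards [h, he.eventually_lt_const hε] with K h2 h3
    linarith
  exact limsup_le_of_le (isBoundedUnder_of ⟨b, hb⟩).isCoboundedUnder_le h1

theorem timeAvg_mem {Ω : Type*} [MeasurableSpace Ω] {P : Measure Ω} [IsProbabilityMeasure P]
    {f : ℕ → Ω → ℝ} {b : ℝ} (hf : ∀ k, Integrable (f k) P)
    (h : ∀ k ω, 0 ≤ f k ω ∧ f k ω ≤ b) (K : ℕ) : 0 ≤ timeAvg P f K ∧ timeAvg P f K ≤ b := by
  have hb : 0 ≤ b := by
    obtain ⟨ω⟩ := P.nonempty_of_neZero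
    exact (h 0 ω).1.trans (h 0 ω).2
  have h1 : ∀ k, ∫ ω, f k ω ∂P ≤ b := fun k => by
    calc _ ≤ ∫ _ω, b ∂P := integral_mono (hf k) (integrable_const b) fun ω => (h k ω).2
      _ = b := by simp
  unfold timeAvg
  refine ⟨div_nonneg (Finset.sum_nonneg fun k _ => integral_nonneg fun ω => (h k ω).1)
    (Nat.cast_nonneg K), div_le_of_le_mul₀ (Nat.cast_nonneg K) hb ?_⟩
  calc _ ≤ ∑ k ∈ Finset.range K, b := Finset.sum_le_sum fun k _ => h1 k
    _ = b * K := by simp [mul_comm]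

theorem tendsto_const_div_nat (a : ℝ) : Tendsto (fun K : ℕ => a / K) atTop (nhds 0) :=
  tendsto_const_div_atTop_nhds_zero_nat a

/-- A sequence whose squares grow at most linearly grows sublinearly. -/
theorem tendsto_div_of_sq_le {y : ℕ → ℝ} {a b : ℝ} (hy : ∀ K, 0 ≤ y K)
    (h : ∀ K : ℕ, y K ^ 2 ≤ a + b * K) : Tendsto (fun K : ℕ => y K / K) atTop (nhds 0) := by
  have h1 : Tendsto (fun K : ℕ => √(a / K * (1 / K) + b / K)) atTop (nhds 0) := by
    have := (((tendsto_const_div_nat a).mul (tendsto_const_div_nat 1)).add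
      (tendsto_const_div_nat b)).sqrt
    simpa using this
  refine squeeze_zero (fun K => div_nonneg (hy K) (Nat.cast_nonneg K)) (fun K => ?_) h1
  refine Real.le_sqrt_of_sq_le ?_
  rcases Nat.eq_zero_or_pos K with h0 | h0
  · simp [h0]
  · have hK : (0 : ℝ) < K := Nat.cast_pos.2 h0
    rw [div_pow, div_le_iff₀ (by positivity)]
    refine (h K).trans (le_of_eq ?_)
    field_simp

theorem sq_integral_le {Ω : Type*} [MeasurableSpace Ω] {P : Measure Ω} [IsProbabilityMeasure P]
    {f : Ω → ℝ} (hf : Integrable f P) (hf2 : Integrable (fun ω => f ω ^ 2) P) :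
    (∫ ω, f ω ∂P) ^ 2 ≤ ∫ ω, f ω ^ 2 ∂P := by
  set m := ∫ ω, f ω ∂P with hm
  have h0 : 0 ≤ ∫ ω, (f ω ^ 2 - (2 * m * f ω - m ^ 2)) ∂P :=
    integral_nonneg fun ω => by
      change 0 ≤ f ω ^ 2 - (2 * m * f ω - m ^ 2)
      nlinarith [sq_nonneg (f ω - m)]
  have hi : Integrable (fun ω => 2 * m * f ω - m ^ 2) P :=
    (hf.const_mul _).sub (integrable_const _)
  rw [integral_sub hf2 hi, integral_sub (hf.const_mul _) (integrable_const _),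
    integral_const_mul, ← hm] at h0
  simp at h0
  nlinarith

section Competitor

variable {RT NRT : Type*} [Fintype RT] [Fintype NRT] [Nonempty NRT] {c : Cell RT}
  {s : Scenario c NRT} {Ω : Type*} [MeasurableSpace Ω] {P : Measure Ω} [IsProbabilityMeasure P]
  {d : Network s P} {π : Policy d}

/-! ### Upper bound on the throughput of admissible policies -/

omit [Nonempty NRT] in
theorem Policy.SlotAdmissible.integral_earned (h : π.SlotAdmissible) (B : ℝ)
    (θ : QueueState RT NRT) (k : ℕ) :
    Integrable (π.earned B θ k) P ∧ ∫ ω, π.earned B θ k ω ∂P =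
      ∑ i, θ.2.1 i * (∫ ω, π.service k (Sum.inl i) ω / c.L ∂P - s.lam (Sum.inl i) * c.q i)
      + ∑ n, (θ.1 n * (∫ ω, π.service k (Sum.inr n) ω ∂P - c.L * ∫ ω, π.r k n ω ∂P)
        + B * c.L * ∫ ω, π.r k n ω ∂P)
      + θ.2.2 * (c.Pavg - ∫ ω, π.power k ω ∂P) := by
  have i1 : ∀ i, Integrable (fun ω => π.service k (Sum.inl i) ω / c.L) P := fun i =>
    (h.integrable_service k _).div_const _
  have i2 : ∀ i, Integrable (fun ω => d.arr k (Sum.inl i) ω * c.q i) P := fun i =>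
    (d.integrable_arr k _).mul_const _
  have i3 : ∀ i, Integrable (fun ω => θ.2.1 i * (π.service k (Sum.inl i) ω / c.L
      - d.arr k (Sum.inl i) ω * c.q i)) P := fun i => ((i1 i).sub (i2 i)).const_mul _
  have i4 : ∀ n, Integrable (fun ω => c.L * π.r k n ω) P := fun n =>
    (h.integrable_r k n).const_mul _
  have i5 : ∀ n, Integrable (fun ω => θ.1 n * (π.service k (Sum.inr n) ω - c.L * π.r k n ω)) P :=
    fun n => ((h.integrable_service k _).sub (i4 n)).const_mul _
  have i6 : ∀ n, Integrable (fun ω => B * c.L * π.r k n ω) P := fun n =>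
    (h.integrable_r k n).const_mul _
  have i7 : Integrable (fun ω => θ.2.2 * (c.Pavg - π.power k ω)) P :=
    ((integrable_const _).sub (h.integrable_power k)).const_mul _
  have i8 := integrable_finsetSum Finset.univ fun i _ => i3 i
  have i9 := integrable_finsetSum Finset.univ fun n _ => (i5 n).add (i6 n)
  refine ⟨(i8.add i9).add i7, ?_⟩
  unfold Policy.earned
  have e1 := integral_add (i8.add i9) i7
  have e2 := integral_add i8 i9
  have e3 := integral_finsetSum Finset.univ fun i _ => i3 i
  have e4 := integral_finsetSum Finset.univ fun n _ => (i5 n).add (i6 n)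
  simp only [Pi.add_apply] at e1 e2 e3 e4
  rw [e1, e2, e3, e4]
  congr 1
  · congr 1
    · refine Finset.sum_congr rfl fun i _ => ?_
      rw [integral_const_mul, integral_sub (i1 i) (i2 i), integral_mul_const, d.integral_arr]
    · refine Finset.sum_congr rfl fun n _ => ?_
      rw [integral_add (i5 n) (i6 n), integral_const_mul,
        integral_sub (h.integrable_service k _) (i4 n), integral_const_mul, integral_const_mul]
  · rw [integral_const_mul, integral_sub (integrable_const _) (h.integrable_power k)]
    simp

omit [Nonempty NRT] [IsProbabilityMeasure P] in
theorem Policy.SlotAdmissible.sent_mem (h : π.SlotAdmissible) (k : ℕ) (n : NRT) (ω : Ω) :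
    0 ≤ π.sent k n ω ∧ π.sent k n ω ≤ π.service k (Sum.inr n) ω :=
  ⟨le_min (h.service_mem k _ ω).1 (add_nonneg (π.Q_nonneg k n ω)
    (mul_nonneg c.L_pos.le (h.r_mem k n ω).1)), min_le_left _ _⟩

omit [Nonempty NRT] in
theorem Policy.SlotAdmissible.integral_throughput (h : π.SlotAdmissible) (k : ℕ) :
    ∫ ω, ∑ n, π.sent k n ω / c.L ∂P = ∑ n, (∫ ω, π.r k n ω ∂P
      - (∫ ω, π.Q (k + 1) n ω ∂P - ∫ ω, π.Q k n ω ∂P) / c.L) := by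
  have hL := c.L_pos
  rw [integral_finsetSum _ fun n _ => (h.integrable_sent k n).div_const _]
  refine Finset.sum_congr rfl fun n _ => ?_
  rw [integral_div, h.integral_sent]
  field_simp

omit [Nonempty NRT] in
theorem Policy.SlotAdmissible.timeAvg_throughput_mem (h : π.SlotAdmissible) (K : ℕ) :
    0 ≤ timeAvg P (fun k ω => ∑ n, π.sent k n ω / c.L) K ∧
      timeAvg P (fun k ω => ∑ n, π.sent k n ω / c.L) K ≤ ∑ _n : NRT, maxService c / c.L := by
  refine timeAvg_mem (fun k => integrable_finsetSum _ fun n _ =>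
    (h.integrable_sent k n).div_const _) (fun k ω => ⟨?_, ?_⟩) K
  · exact Finset.sum_nonneg fun n _ => div_nonneg (h.sent_mem k n ω).1 c.L_pos.le
  · exact Finset.sum_le_sum fun n _ => div_le_div_of_nonneg_right
      ((h.sent_mem k n ω).2.trans (h.service_mem k _ ω).2) c.L_pos.le

omit [Nonempty NRT] in
theorem Policy.SlotAdmissible.timeAvg_service_mem (h : π.SlotAdmissible) (i : RT) (K : ℕ) :
    0 ≤ timeAvg P (fun k ω => π.service k (Sum.inl i) ω / c.L) K ∧
      timeAvg P (fun k ω => π.service k (Sum.inl i) ω / c.L) K ≤ 1 :=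
  timeAvg_mem (fun k => (h.integrable_service k _).div_const _)
    (fun k ω => h.service_div_mem k i ω) K

omit [Nonempty NRT] in
theorem Policy.SlotAdmissible.timeAvg_power_mem (h : π.SlotAdmissible) (K : ℕ) :
    0 ≤ timeAvg P π.power K ∧ timeAvg P π.power K ≤ c.Pmax :=
  timeAvg_mem h.integrable_power h.power_mem K

-- The stability constraint of a competitor enters through this limit: its final backlog is
-- negligible on average.
omit [Nonempty NRT] in
theorem Policy.Admissible.tendsto_integral_Q_div (h : π.Admissible) (n : NRT) :
    Tendsto (fun K : ℕ => (∫ ω, π.Q K n ω ∂P) / K) atTop (nhds 0) := by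
  obtain ⟨b, hb, hb'⟩ := exists_between (h.stable n)
  have h1 := eventually_lt_of_limsup_lt hb
  have h0 : ∀ K, 0 ≤ ∫ ω, π.Q K n ω ∂P := fun K => integral_nonneg fun ω => π.Q_nonneg K n ω
  refine squeeze_zero' (Eventually.of_forall fun K => div_nonneg (h0 K) (Nat.cast_nonneg K))
    ?_ (tendsto_const_div_nat b.toReal)
  filter_upwards [h1] with K hK
  refine div_le_div_of_nonneg_right ?_ (Nat.cast_nonneg K)
  rw [integral_eq_lintegral_of_nonneg_ae (ae_of_all _ fun ω => π.Q_nonneg K n ω)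
    (h.slotAdmissible.integrable_Q K n).aestronglyMeasurable]
  exact ENNReal.toReal_mono hb'.ne hK.le

/-- Averaged over time, an admissible policy earns no more than the optimal reward. -/
theorem Policy.SlotAdmissible.timeAvg_le_reward (h : π.SlotAdmissible) {B : ℝ} (hB : 0 < B)
    {θ : QueueState RT NRT} (hQ : ∀ n, 0 ≤ θ.1 n) (hY : ∀ i, 0 ≤ θ.2.1 i) (hX : 0 ≤ θ.2.2)
    {K : ℕ} (hK : 0 < K) :
    ∑ i, θ.2.1 i * (timeAvg P (fun k ω => π.service k (Sum.inl i) ω / c.L) K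
        - s.lam (Sum.inl i) * c.q i)
      + ∑ n, (B - θ.1 n) * ((∫ ω, π.Q K n ω ∂P) / K - s.Q₀ n / K)
      + θ.2.2 * (c.Pavg - timeAvg P π.power K)
      + B * c.L * timeAvg P (fun k ω => ∑ n, π.sent k n ω / c.L) K
      ≤ ∫ x, reward c B (θ, x) ∂s.slotLaw := by
  have hL := c.L_pos
  have hK' : (0 : ℝ) < K := Nat.cast_pos.2 hK
  have step : ∀ k, ∑ i, θ.2.1 i * (∫ ω, π.service k (Sum.inl i) ω / c.L ∂P
        - s.lam (Sum.inl i) * c.q i)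
      + ∑ n, (B - θ.1 n) * (∫ ω, π.Q (k + 1) n ω ∂P - ∫ ω, π.Q k n ω ∂P)
      + θ.2.2 * (c.Pavg - ∫ ω, π.power k ω ∂P)
      + B * c.L * ∫ ω, ∑ n, π.sent k n ω / c.L ∂P
      ≤ ∫ x, reward c B (θ, x) ∂s.slotLaw := by
    intro k
    obtain ⟨he, hee⟩ := h.integral_earned B θ k
    have h1 := integral_mono he (integrable_reward_slot d hB hQ hY hX k) fun ω =>
      h.earned_le B θ k ω
    rw [integral_reward_slot, hee] at h1
    refine le_trans ?_ h1
    rw [h.integral_throughput, Finset.mul_sum]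
    -- Service is at least the bits sent, `L r - ΔQ`. As `θ ≥ 0`, `θ * (service - L r) ≥ -θ * ΔQ`;
    -- and `B L r` equals `B` times the bits sent plus `B * ΔQ`. The `ΔQ` terms telescope over the
    -- slots.
    have h2 : ∑ n, (B - θ.1 n) * (∫ ω, π.Q (k + 1) n ω ∂P - ∫ ω, π.Q k n ω ∂P)
        + ∑ n, B * c.L * (∫ ω, π.r k n ω ∂P
          - (∫ ω, π.Q (k + 1) n ω ∂P - ∫ ω, π.Q k n ω ∂P) / c.L)
        ≤ ∑ n, (θ.1 n * (∫ ω, π.service k (Sum.inr n) ω ∂P - c.L * ∫ ω, π.r k n ω ∂P)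
          + B * c.L * ∫ ω, π.r k n ω ∂P) := by
      rw [← Finset.sum_add_distrib]
      refine Finset.sum_le_sum fun n _ => ?_
      have h3 := integral_mono (h.integrable_sent k n) (h.integrable_service k (Sum.inr n))
        fun ω => (h.sent_mem k n ω).2
      rw [h.integral_sent] at h3
      have h4 := mul_le_mul_of_nonneg_left h3 (hQ n)
      have h5 : B * c.L * (∫ ω, π.r k n ω ∂P
          - (∫ ω, π.Q (k + 1) n ω ∂P - ∫ ω, π.Q k n ω ∂P) / c.L)
          = B * c.L * ∫ ω, π.r k n ω ∂P
            - B * (∫ ω, π.Q (k + 1) n ω ∂P - ∫ ω, π.Q k n ω ∂P) := by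
        field_simp
      rw [h5]
      linarith
    linarith
  have hsum := Finset.sum_le_sum fun k (_ : k ∈ Finset.range K) => step k
  simp only [Finset.sum_add_distrib, Finset.sum_const, Finset.card_range, nsmul_eq_mul] at hsum
  rw [Finset.sum_comm, Finset.sum_comm (s := Finset.range K)] at hsum
  simp only [← Finset.mul_sum, Finset.sum_sub_distrib, Finset.sum_const, Finset.card_range,
    nsmul_eq_mul] at hsum
  have htel : ∀ n, ∑ k ∈ Finset.range K, ∫ ω, π.Q (k + 1) n ω ∂P
      - ∑ k ∈ Finset.range K, ∫ ω, π.Q k n ω ∂P = ∫ ω, π.Q K n ω ∂P - s.Q₀ n := by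
    intro n
    rw [← Finset.sum_sub_distrib, Finset.sum_range_sub (fun k => ∫ ω, π.Q k n ω ∂P)]
    simp [Policy.Q]
  simp only [htel] at hsum
  rw [← div_le_iff₀' hK'] at hsum
  refine le_trans (le_of_eq ?_) hsum
  unfold timeAvg
  simp only [add_div, Finset.sum_div]
  congr 1
  · congr 1
    · congr 1
      · refine Finset.sum_congr rfl fun i _ => ?_
        rw [← Finset.sum_div]; field_simp
      · refine Finset.sum_congr rfl fun n _ => ?_
        field_simp
    · rw [← Finset.sum_div]; field_simp
  · rw [← Finset.sum_div]; field_simp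

/-- Weak duality: in the time-averaged inequality the constraint terms have nonnegative weights and
are asymptotically nonnegative, while the backlog terms tend to zero. -/
theorem Policy.Admissible.throughput_le_reward (h : π.Admissible) {B : ℝ} (hB : 0 < B)
    {θ : QueueState RT NRT} (hQ : ∀ n, 0 ≤ θ.1 n) (hY : ∀ i, 0 ≤ θ.2.1 i) (hX : 0 ≤ θ.2.2) :
    B * c.L * π.throughput ≤ ∫ x, reward c B (θ, x) ∂s.slotLaw := by
  have hL := c.L_pos
  have hs := h.slotAdmissible
  -- `M` collects the coefficients of the error `ε` from delivery, backlog, power and throughput,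
  -- all controlled at one common `K`.
  set M : ℝ := ∑ i, θ.2.1 i + 1 + θ.2.2 + B * c.L with hM
  have hMpos : 0 < M := by
    have : 0 ≤ ∑ i, θ.2.1 i := Finset.sum_nonneg fun i _ => hY i
    positivity
  refine le_of_forall_pos_le_add fun δ hδ => ?_
  obtain ⟨ε, hε, hεδ⟩ : ∃ ε, 0 < ε ∧ ε * M = δ := ⟨δ / M, by positivity, by field_simp⟩
  have h1 : ∀ᶠ K in atTop, ∀ i, s.lam (Sum.inl i) * c.q i - ε
      < timeAvg P (fun k ω => π.service k (Sum.inl i) ω / c.L) K := by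
    rw [eventually_all]
    intro i
    refine eventually_lt_of_lt_liminf (lt_of_lt_of_le (by linarith) (h.delivery i))
      (isBoundedUnder_of ⟨0, fun K => (hs.timeAvg_service_mem i K).1⟩)
  have h2 : ∀ᶠ K in atTop, timeAvg P π.power K < c.Pavg + ε :=
    eventually_lt_of_limsup_lt (lt_of_le_of_lt h.average (by linarith))
      (isBoundedUnder_of ⟨c.Pmax, fun K => (hs.timeAvg_power_mem K).2⟩)
  have h3 : ∀ᶠ K in atTop, π.throughput - ε
      < timeAvg P (fun k ω => ∑ n, π.sent k n ω / c.L) K :=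
    eventually_lt_of_lt_liminf (show π.throughput - ε < π.throughput by linarith)
      (isBoundedUnder_of ⟨0, fun K => (hs.timeAvg_throughput_mem K).1⟩)
  have h4 : Tendsto (fun K : ℕ => ∑ n, (B - θ.1 n) * ((∫ ω, π.Q K n ω ∂P) / K - s.Q₀ n / K))
      atTop (nhds 0) := by
    have := tendsto_finsetSum Finset.univ fun n (_ : n ∈ Finset.univ) =>
      ((h.tendsto_integral_Q_div n).sub (tendsto_const_div_nat (s.Q₀ n))).const_mul (B - θ.1 n)
    simpa using this
  have h5 := h4.eventually_const_lt (show -ε < 0 by linarith)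
  obtain ⟨K, k1, k2, k3, k5, hK⟩ :=
    (h1.and (h2.and (h3.and (h5.and (eventually_gt_atTop 0))))).exists
  have key := hs.timeAvg_le_reward hB hQ hY hX hK
  have j1 : -(ε * ∑ i, θ.2.1 i) ≤ ∑ i, θ.2.1 i *
      (timeAvg P (fun k ω => π.service k (Sum.inl i) ω / c.L) K
        - s.lam (Sum.inl i) * c.q i) := by
    rw [Finset.mul_sum, ← Finset.sum_neg_distrib]
    refine Finset.sum_le_sum fun i _ => ?_
    have := mul_le_mul_of_nonneg_left (k1 i).le (hY i)
    linarith
  have j2 : -(ε * θ.2.2) ≤ θ.2.2 * (c.Pavg - timeAvg P π.power K) := by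
    have := mul_le_mul_of_nonneg_left k2.le hX
    linarith
  have j3 := mul_le_mul_of_nonneg_left k3.le (by positivity : 0 ≤ B * c.L)
  rw [← hεδ, hM]
  linarith

end Competitor

section Lyapunov

variable {RT NRT : Type*} [Fintype RT] [Fintype NRT] {c : Cell RT}
  {s : Scenario c NRT} {Ω : Type*} [MeasurableSpace Ω] {P : Measure Ω}
  {d : Network s P} {π : Policy d}

/-! ### Drift of the Lambert-Strict algorithm -/

/-- Half the sum of the squares of all queues. -/
noncomputable def Policy.lyapunov (π : Policy d) (k : ℕ) (ω : Ω) : ℝ :=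
  (∑ n, π.Q k n ω ^ 2 + ∑ i, π.Y k i ω ^ 2 + π.X k ω ^ 2) / 2

variable (NRT) in
/-- The bound on the second-order terms of the drift. -/
noncomputable def driftConst (c : Cell RT) : ℝ :=
  (∑ _n : NRT, (c.L ^ 2 + maxService c ^ 2) + ∑ _i : RT, (1 : ℝ) + (c.Pmax ^ 2 + c.Pavg ^ 2)) / 2

theorem max_add_zero_sq_le (x δ : ℝ) : max (x + δ) 0 ^ 2 ≤ x ^ 2 + 2 * (x * δ) + δ ^ 2 := by
  rcases le_total (x + δ) 0 with h | h
  · rw [max_eq_right h]; nlinarith [sq_nonneg (x + δ)]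
  · rw [max_eq_left h]; nlinarith

theorem sub_sq_le {x y a b : ℝ} (hx : 0 ≤ x) (hxa : x ≤ a) (hy : 0 ≤ y) (hyb : y ≤ b) :
    (x - y) ^ 2 ≤ a ^ 2 + b ^ 2 := by
  nlinarith [mul_nonneg hx hy]

/-- Squaring the queue recursions, the cross terms are `-earned` at the current queues, up to the
admission bonus `B * L * r` that `earned` contains. The squared increments are bounded by the
constant. -/
theorem Policy.SlotAdmissible.lyapunov_succ_le (h : π.SlotAdmissible) (B : ℝ) (k : ℕ) (ω : Ω) :
    π.lyapunov (k + 1) ω ≤ π.lyapunov k ω + driftConst NRT c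
      + B * c.L * ∑ n, π.r k n ω - π.earned B (π.state k ω) k ω := by
  have hL := c.L_pos
  have hQ : ∑ n, π.Q (k + 1) n ω ^ 2 ≤ ∑ n, (π.Q k n ω ^ 2
      + 2 * (π.Q k n ω * (c.L * π.r k n ω - π.service k (Sum.inr n) ω))
      + (c.L ^ 2 + maxService c ^ 2)) := Finset.sum_le_sum fun n _ => by
    obtain ⟨hr0, hr1⟩ := h.r_mem k n ω
    obtain ⟨hs0, hs1⟩ := h.service_mem k (Sum.inr n) ω
    have h1 := sub_sq_le (mul_nonneg hL.le hr0) (mul_le_of_le_one_right hL.le hr1) hs0 hs1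
    have h2 := max_add_zero_sq_le (π.Q k n ω) (c.L * π.r k n ω - π.service k (Sum.inr n) ω)
    rw [← add_sub_assoc] at h2
    exact h2.trans (by linarith)
  have hY : ∑ i, π.Y (k + 1) i ω ^ 2 ≤ ∑ i, (π.Y k i ω ^ 2
      + 2 * (π.Y k i ω * (d.arr k (Sum.inl i) ω * c.q i - π.service k (Sum.inl i) ω / c.L))
      + 1) := Finset.sum_le_sum fun i _ => by
    obtain ⟨ha0, ha1⟩ := d.arr_mem_Icc k (Sum.inl i) ω
    obtain ⟨hq0, hq1⟩ := c.q_mem i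
    obtain ⟨hs0, hs1⟩ := h.service_div_mem k i ω
    have ha : d.arr k (Sum.inl i) ω * c.q i ≤ 1 := mul_le_one₀ ha1 hq0 hq1
    have ha' : 0 ≤ d.arr k (Sum.inl i) ω * c.q i := mul_nonneg ha0 hq0
    have h1 : (d.arr k (Sum.inl i) ω * c.q i - π.service k (Sum.inl i) ω / c.L) ^ 2 ≤ 1 :=
      (sq_le_one_iff_abs_le_one _).2 (abs_le.2 ⟨by linarith, by linarith⟩)
    have h2 := max_add_zero_sq_le (π.Y k i ω)
      (d.arr k (Sum.inl i) ω * c.q i - π.service k (Sum.inl i) ω / c.L)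
    rw [← add_sub_assoc] at h2
    rw [h.Y_succ]
    exact h2.trans (by linarith)
  have hX : π.X (k + 1) ω ^ 2 ≤ π.X k ω ^ 2 + 2 * (π.X k ω * (π.power k ω - c.Pavg))
      + (c.Pmax ^ 2 + c.Pavg ^ 2) := by
    obtain ⟨hp0, hp1⟩ := h.power_mem k ω
    have h1 := sub_sq_le hp0 hp1 c.Pavg_pos.le le_rfl
    have h2 := max_add_zero_sq_le (π.X k ω) (π.power k ω - c.Pavg)
    rw [← add_sub_assoc] at h2
    exact h2.trans (by linarith)
  simp only [Finset.sum_add_distrib, ← Finset.mul_sum] at hQ hY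
  have e1 : ∑ n, π.Q k n ω * (c.L * π.r k n ω - π.service k (Sum.inr n) ω)
      = -∑ n, π.Q k n ω * (π.service k (Sum.inr n) ω - c.L * π.r k n ω) := by
    rw [← Finset.sum_neg_distrib]; exact Finset.sum_congr rfl fun n _ => by ring
  have e2 : ∑ i, π.Y k i ω * (d.arr k (Sum.inl i) ω * c.q i - π.service k (Sum.inl i) ω / c.L)
      = -∑ i, π.Y k i ω *
        (π.service k (Sum.inl i) ω / c.L - d.arr k (Sum.inl i) ω * c.q i) := by
    rw [← Finset.sum_neg_distrib]; exact Finset.sum_congr rfl fun i _ => by ring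
  have e3 : π.earned B (π.state k ω) k ω
      = ∑ i, π.Y k i ω * (π.service k (Sum.inl i) ω / c.L - d.arr k (Sum.inl i) ω * c.q i)
      + (∑ n, π.Q k n ω * (π.service k (Sum.inr n) ω - c.L * π.r k n ω)
        + B * c.L * ∑ n, π.r k n ω)
      + π.X k ω * (c.Pavg - π.power k ω) := by
    unfold Policy.earned Policy.state
    simp only [Finset.sum_add_distrib, ← Finset.mul_sum]
  rw [e1] at hQ
  rw [e2] at hY
  rw [e3]
  unfold Policy.lyapunov driftConst
  simp only [Finset.sum_add_distrib] at hQ hY ⊢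
  linarith

theorem Policy.lyapunov_nonneg (π : Policy d) (k : ℕ) (ω : Ω) : 0 ≤ π.lyapunov k ω := by
  unfold Policy.lyapunov; positivity

/-- Below `B` one slot adds at most `L` bits; from `B` on nothing is admitted, so a larger initial
backlog can only shrink. -/
theorem Policy.IsLambertStrict.Q_le_max {B : ℝ} (h : π.IsLambertStrict B) (hB : 0 < B) (k : ℕ)
    (n : NRT) (ω : Ω) : π.Q k n ω ≤ max (s.Q₀ n) (B + c.L) := by
  have hL := c.L_pos
  induction k with
  | zero => exact le_max_left _ _
  | succ k ih =>
    have hr : (π.Q k n ω < B → π.r k n ω = d.arr k (Sum.inr n) ω) ∧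
      (B ≤ π.Q k n ω → π.r k n ω = 0) := (h k ω).1 n
    have hs := (h.slotAdmissible.service_mem k (Sum.inr n) ω).1
    have hr1 := (h.slotAdmissible.r_mem k n ω).2
    refine max_le ?_ (le_max_of_le_right (by positivity))
    rcases lt_or_ge (π.Q k n ω) B with hlt | hge
    · refine le_max_of_le_right ?_
      nlinarith
    · rw [hr.2 hge]
      linarith

/-! ### Accumulated drift, constraints and throughput of the algorithm. -/

variable [IsProbabilityMeasure P]

theorem Policy.SlotAdmissible.integrable_lyapunov (h : π.SlotAdmissible) (k : ℕ) :
    Integrable (π.lyapunov k) P :=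
  (((integrable_finsetSum _ fun n _ => h.integrable_Q_sq k n).add
    (integrable_finsetSum _ fun i _ => h.integrable_Y_sq k i)).add
    (h.integrable_X_sq k)).div_const 2

theorem Policy.IsLambertStrict.stable {B : ℝ} (h : π.IsLambertStrict B) (hB : 0 < B) (n : NRT) :
    limsup (fun k => ∫⁻ ω, ENNReal.ofReal (π.Q k n ω) ∂P) atTop < ⊤ := by
  refine lt_of_le_of_lt (limsup_le_of_le (a := ENNReal.ofReal (max (s.Q₀ n) (B + c.L)))
    (by isBoundedDefault) (Eventually.of_forall fun k => ?_)) ENNReal.ofReal_lt_top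
  calc ∫⁻ ω, ENNReal.ofReal (π.Q k n ω) ∂P
      ≤ ∫⁻ _ω, ENNReal.ofReal (max (s.Q₀ n) (B + c.L)) ∂P :=
        lintegral_mono fun ω => ENNReal.ofReal_le_ofReal (h.Q_le_max hB k n ω)
    _ = _ := by simp

variable [Nonempty NRT]

/-- The accumulated drift, if some admissible policy has throughput at least `t`. -/
theorem Policy.IsLambertStrict.integral_lyapunov_le {B t : ℝ} (h : π.IsLambertStrict B)
    (hB : 0 < B)
    (ht : ∀ θ : QueueState RT NRT, (∀ n, 0 ≤ θ.1 n) → (∀ i, 0 ≤ θ.2.1 i) → 0 ≤ θ.2.2 →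
      B * c.L * t ≤ ∫ x, reward c B (θ, x) ∂s.slotLaw) (K : ℕ) :
    ∫ ω, π.lyapunov K ω ∂P ≤ ∫ ω, π.lyapunov 0 ω ∂P + K * (driftConst NRT c - B * c.L * t)
      + B * c.L * ∑ k ∈ Finset.range K, ∑ n, ∫ ω, π.r k n ω ∂P := by
  have hs := h.slotAdmissible
  induction K with
  | zero => simp
  | succ k ih =>
    have hr := integrable_finsetSum Finset.univ fun n _ => hs.integrable_r k n
    have hi1 : Integrable (fun ω => π.lyapunov k ω + driftConst NRT c) P :=
      (hs.integrable_lyapunov k).add (integrable_const _)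
    have hi2 : Integrable (fun ω => π.lyapunov k ω + driftConst NRT c
        + B * c.L * ∑ n, π.r k n ω) P := hi1.add (hr.const_mul _)
    have hstep := integral_mono (hs.integrable_lyapunov (k + 1))
      (hi2.sub (hs.integrable_reward hB k)) fun ω => by
        have := hs.lyapunov_succ_le B k ω
        rwa [h.earned_eq] at this
    -- The current queues are nonnegative weights, so the bound in `ht` passes to the expected
    -- reward.
    have hrew := hs.le_integral_reward hB ht k
    simp only [Pi.sub_apply] at hstep
    rw [integral_sub hi2 (hs.integrable_reward hB k), integral_add hi1 (hr.const_mul _),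
      integral_add (hs.integrable_lyapunov k) (integrable_const _), integral_const_mul,
      integral_finsetSum _ fun n _ => hs.integrable_r k n] at hstep
    simp only [integral_const, probReal_univ, smul_eq_mul, one_mul] at hstep
    rw [Finset.sum_range_succ]
    push_cast
    linarith

theorem Policy.IsLambertStrict.exists_integral_lyapunov_le {B t : ℝ} (h : π.IsLambertStrict B)
    (hB : 0 < B)
    (ht : ∀ θ : QueueState RT NRT, (∀ n, 0 ≤ θ.1 n) → (∀ i, 0 ≤ θ.2.1 i) → 0 ≤ θ.2.2 →
      B * c.L * t ≤ ∫ x, reward c B (θ, x) ∂s.slotLaw) :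
    ∃ a b : ℝ, ∀ K : ℕ, ∫ ω, π.lyapunov K ω ∂P ≤ a + b * K := by
  have hL := c.L_pos
  have hs := h.slotAdmissible
  refine ⟨∫ ω, π.lyapunov 0 ω ∂P,
    driftConst NRT c - B * c.L * t + B * c.L * ∑ _n : NRT, (1 : ℝ), fun K => ?_⟩
  have h1 := h.integral_lyapunov_le hB ht K
  have h2 : ∑ k ∈ Finset.range K, ∑ n, ∫ ω, π.r k n ω ∂P ≤ K * ∑ _n : NRT, (1 : ℝ) := by
    calc _ ≤ ∑ k ∈ Finset.range K, ∑ _n : NRT, (1 : ℝ) :=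
          Finset.sum_le_sum fun k _ => Finset.sum_le_sum fun n _ => by
            calc _ ≤ ∫ _ω, (1 : ℝ) ∂P :=
                  integral_mono (hs.integrable_r k n) (integrable_const 1)
                    fun ω => (hs.r_mem k n ω).2
              _ = 1 := by simp
      _ = _ := by rw [Finset.sum_const, Finset.card_range, nsmul_eq_mul]
  have h3 := mul_le_mul_of_nonneg_left h2 (by positivity : 0 ≤ B * c.L)
  linarith

/-- The accumulated delivery deficit is at most `E[Y_K]`. Since `E[Y_K]² ≤ E[Y_K²] ≤ 2 E[V_K]` grows
at most linearly, `E[Y_K] / K` tends to zero. The power constraint is treated in the same way with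
`X`. -/
theorem Policy.IsLambertStrict.delivery {B t : ℝ} (h : π.IsLambertStrict B) (hB : 0 < B)
    (ht : ∀ θ : QueueState RT NRT, (∀ n, 0 ≤ θ.1 n) → (∀ i, 0 ≤ θ.2.1 i) → 0 ≤ θ.2.2 →
      B * c.L * t ≤ ∫ x, reward c B (θ, x) ∂s.slotLaw) (i : RT) :
    s.lam (Sum.inl i) * c.q i ≤
      liminf (timeAvg P fun k ω => π.service k (Sum.inl i) ω / c.L) atTop := by
  have hs := h.slotAdmissible
  obtain ⟨a, b, hab⟩ := h.exists_integral_lyapunov_le hB ht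
  have hlim : Tendsto (fun K : ℕ => (∫ ω, π.Y K i ω ∂P) / K) atTop (nhds 0) := by
    refine tendsto_div_of_sq_le (a := 2 * a) (b := 2 * b)
      (fun K => integral_nonneg fun ω => π.Y_nonneg K i ω) fun K => ?_
    have h1 := sq_integral_le (hs.integrable_Y K i) (hs.integrable_Y_sq K i)
    have h2 : ∫ ω, π.Y K i ω ^ 2 ∂P ≤ ∫ ω, 2 * π.lyapunov K ω ∂P :=
      integral_mono (hs.integrable_Y_sq K i) ((hs.integrable_lyapunov K).const_mul 2) fun ω => by
        have h3 := Finset.single_le_sum (fun j _ => sq_nonneg (π.Y K j ω)) (Finset.mem_univ i)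
        have h4 : 0 ≤ ∑ n, π.Q K n ω ^ 2 := by positivity
        have h5 := sq_nonneg (π.X K ω)
        simp only [Policy.lyapunov]
        linarith
    rw [integral_const_mul] at h2
    linarith [hab K]
  refine le_liminf_of_sub_le (fun K => (hs.timeAvg_service_mem i K).2) ?_ hlim
  have hstep : ∀ k, ∫ ω, π.Y k i ω ∂P + s.lam (Sum.inl i) * c.q i
      - ∫ ω, π.service k (Sum.inl i) ω / c.L ∂P ≤ ∫ ω, π.Y (k + 1) i ω ∂P := by
    intro k
    have i1 : Integrable (fun ω => d.arr k (Sum.inl i) ω * c.q i) P :=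
      (d.integrable_arr k _).mul_const _
    have i2 : Integrable (fun ω => π.service k (Sum.inl i) ω / c.L) P :=
      (hs.integrable_service k _).div_const _
    have i3 : Integrable (fun ω => π.Y k i ω + d.arr k (Sum.inl i) ω * c.q i) P :=
      (hs.integrable_Y k i).add i1
    have h1 := integral_mono (i3.sub i2) (hs.integrable_Y (k + 1) i) fun ω => by
      rw [hs.Y_succ]; exact le_max_left _ _
    simp only [Pi.sub_apply] at h1
    rwa [integral_sub i3 i2, integral_add (hs.integrable_Y k i) i1, integral_mul_const,
      d.integral_arr] at h1
  have hsum : ∀ K : ℕ, K * (s.lam (Sum.inl i) * c.q i)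
      - ∑ k ∈ Finset.range K, ∫ ω, π.service k (Sum.inl i) ω / c.L ∂P ≤ ∫ ω, π.Y K i ω ∂P := by
    intro K
    induction K with
    | zero => simp [Policy.Y]
    | succ k ih =>
      rw [Finset.sum_range_succ]
      push_cast
      linarith [hstep k]
  filter_upwards [eventually_gt_atTop 0] with K hK
  have hK' : (0 : ℝ) < K := Nat.cast_pos.2 hK
  unfold timeAvg
  rw [le_div_iff₀ hK', sub_mul, div_mul_cancel₀ _ hK'.ne']
  linarith [hsum K]

theorem Policy.IsLambertStrict.average {B t : ℝ} (h : π.IsLambertStrict B) (hB : 0 < B)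
    (ht : ∀ θ : QueueState RT NRT, (∀ n, 0 ≤ θ.1 n) → (∀ i, 0 ≤ θ.2.1 i) → 0 ≤ θ.2.2 →
      B * c.L * t ≤ ∫ x, reward c B (θ, x) ∂s.slotLaw) :
    limsup (timeAvg P π.power) atTop ≤ c.Pavg := by
  have hs := h.slotAdmissible
  obtain ⟨a, b, hab⟩ := h.exists_integral_lyapunov_le hB ht
  have hlim : Tendsto (fun K : ℕ => (∫ ω, π.X K ω ∂P) / K) atTop (nhds 0) := by
    refine tendsto_div_of_sq_le (a := 2 * a) (b := 2 * b)
      (fun K => integral_nonneg fun ω => π.X_nonneg K ω) fun K => ?_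
    have h1 := sq_integral_le (hs.integrable_X K) (hs.integrable_X_sq K)
    have h2 : ∫ ω, π.X K ω ^ 2 ∂P ≤ ∫ ω, 2 * π.lyapunov K ω ∂P :=
      integral_mono (hs.integrable_X_sq K) ((hs.integrable_lyapunov K).const_mul 2) fun ω => by
        have h3 : 0 ≤ ∑ i, π.Y K i ω ^ 2 := by positivity
        have h4 : 0 ≤ ∑ n, π.Q K n ω ^ 2 := by positivity
        simp only [Policy.lyapunov]
        linarith
    rw [integral_const_mul] at h2
    linarith [hab K]
  refine limsup_le_of_le_add (fun K => (hs.timeAvg_power_mem K).1) ?_ hlim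
  have hstep : ∀ k, ∫ ω, π.X k ω ∂P + ∫ ω, π.power k ω ∂P - c.Pavg ≤ ∫ ω, π.X (k + 1) ω ∂P := by
    intro k
    have i3 : Integrable (fun ω => π.X k ω + π.power k ω) P :=
      (hs.integrable_X k).add (hs.integrable_power k)
    have h1 := integral_mono (i3.sub (integrable_const c.Pavg)) (hs.integrable_X (k + 1))
      fun ω => le_max_left _ _
    simp only [Pi.sub_apply] at h1
    rw [integral_sub i3 (integrable_const _),
      integral_add (hs.integrable_X k) (hs.integrable_power k)] at h1
    simpa using h1
  have hsum : ∀ K : ℕ, ∑ k ∈ Finset.range K, ∫ ω, π.power k ω ∂P - K * c.Pavg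
      ≤ ∫ ω, π.X K ω ∂P := by
    intro K
    induction K with
    | zero => simp [Policy.X]
    | succ k ih =>
      rw [Finset.sum_range_succ]
      push_cast
      linarith [hstep k]
  filter_upwards [eventually_gt_atTop 0] with K hK
  have hK' : (0 : ℝ) < K := Nat.cast_pos.2 hK
  unfold timeAvg
  rw [div_le_iff₀ hK', add_mul, div_mul_cancel₀ _ hK'.ne']
  linarith [hsum K]

theorem Policy.IsLambertStrict.admissible {B t : ℝ} (h : π.IsLambertStrict B) (hB : 0 < B)
    (ht : ∀ θ : QueueState RT NRT, (∀ n, 0 ≤ θ.1 n) → (∀ i, 0 ≤ θ.2.1 i) → 0 ≤ θ.2.2 →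
      B * c.L * t ≤ ∫ x, reward c B (θ, x) ∂s.slotLaw) : π.Admissible where
  admission := h.slotAdmissible.admission
  realTime k i ω := (h.slotAdmissible.slot k ω).realTime i
  peak k i ω := (h.slotAdmissible.slot k ω).peak i
  duration k i ω := (h.slotAdmissible.slot k ω).duration i
  slot k ω := (h.slotAdmissible.slot k ω).slot
  stable := h.stable hB
  delivery := h.delivery hB ht
  average := h.average hB ht

theorem Policy.IsLambertStrict.le_throughput {B t : ℝ} (h : π.IsLambertStrict B) (hB : 0 < B)
    (ht : ∀ θ : QueueState RT NRT, (∀ n, 0 ≤ θ.1 n) → (∀ i, 0 ≤ θ.2.1 i) → 0 ≤ θ.2.2 →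
      B * c.L * t ≤ ∫ x, reward c B (θ, x) ∂s.slotLaw) :
    t - driftConst NRT c / (c.L * B) ≤ π.throughput := by
  have hL := c.L_pos
  have hs := h.slotAdmissible
  -- The initial Lyapunov value and the final backlog are bounded in `K`; divided by `K` they
  -- vanish, which keeps the initial queues out of the constant.
  refine le_liminf_of_sub_le (fun K => (hs.timeAvg_throughput_mem K).2) ?_
    (tendsto_const_div_nat ((∫ ω, π.lyapunov 0 ω ∂P) / (c.L * B)
      + ∑ n, max (s.Q₀ n) (B + c.L) / c.L))
  filter_upwards [eventually_gt_atTop 0] with K hK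
  have hK' : (0 : ℝ) < K := Nat.cast_pos.2 hK
  have h0 : 0 ≤ ∫ ω, π.lyapunov K ω ∂P := integral_nonneg fun ω => π.lyapunov_nonneg K ω
  have h1 := h0.trans (h.integral_lyapunov_le hB ht K)
  set ρ := ∑ k ∈ Finset.range K, ∑ n, ∫ ω, π.r k n ω ∂P
  set v := ∫ ω, π.lyapunov 0 ω ∂P
  have e : ∑ k ∈ Finset.range K, ∫ ω, ∑ n, π.sent k n ω / c.L ∂P
      = ρ - ∑ n, (∫ ω, π.Q K n ω ∂P - s.Q₀ n) / c.L := by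
    rw [Finset.sum_congr rfl fun k _ => hs.integral_throughput k]
    simp only [Finset.sum_sub_distrib]
    congr 1
    rw [Finset.sum_comm]
    refine Finset.sum_congr rfl fun n _ => ?_
    rw [← Finset.sum_div, Finset.sum_range_sub (fun k => ∫ ω, π.Q k n ω ∂P)]
    simp [Policy.Q]
  have h2 : ∑ n, (∫ ω, π.Q K n ω ∂P - s.Q₀ n) / c.L ≤ ∑ n, max (s.Q₀ n) (B + c.L) / c.L := by
    refine Finset.sum_le_sum fun n _ => div_le_div_of_nonneg_right ?_ hL.le
    have h3 : ∫ ω, π.Q K n ω ∂P ≤ ∫ _ω, max (s.Q₀ n) (B + c.L) ∂P :=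
      integral_mono (hs.integrable_Q K n) (integrable_const _) fun ω => h.Q_le_max hB K n ω
    simp only [integral_const, probReal_univ, smul_eq_mul, one_mul] at h3
    linarith [s.Q₀_nonneg n]
  -- This is the accumulated drift with `E[V_K] ≥ 0`, divided by the weight `L * B` of an admission.
  have h4 : K * (t - driftConst NRT c / (c.L * B)) - v / (c.L * B) ≤ ρ := by
    have h5 : (K * (t - driftConst NRT c / (c.L * B)) - v / (c.L * B)) * (c.L * B)
        = K * (B * c.L * t - driftConst NRT c) - v := by field_simp
    refine le_of_mul_le_mul_right ?_ (mul_pos hL hB)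
    rw [h5]
    linarith
  unfold timeAvg
  rw [le_div_iff₀ hK', sub_mul, div_mul_cancel₀ _ hK'.ne', e]
  linarith

end Lyapunov

end Scheduling

theorem mainTheorem3 {RT NRT : Type*} [Fintype RT] [Fintype NRT] [Nonempty NRT]
    (c : Scheduling.Cell RT) :
    ∃ C₂ : ℝ, ∀ s : Scheduling.Scenario c NRT, Scheduling.Feasible s →
      ∀ B : ℝ, 0 < B →
      ∀ (Ω : Type*) [MeasurableSpace Ω] (P : Measure Ω) [IsProbabilityMeasure P]
        (d : Scheduling.Network s P) (π : Scheduling.Policy d), π.IsLambertStrict B →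
        π.Admissible ∧
        Scheduling.optimalThroughput s - ((C₂ / (c.L * B) : ℝ) : EReal) ≤ (π.throughput : ℝ) := by
  -- `driftConst` involves only the numbers of users and the cell parameters, neither the scenario
  -- nor `B`. For admissibility, the throughput of any one admissible policy serves as `t`.
  refine ⟨Scheduling.driftConst NRT c, fun s hs B hB Ω _ P _ d π h => ⟨?_, ?_⟩⟩
  · obtain ⟨Ω', _, P', _, d', π', h'⟩ := hs
    exact h.admissible hB fun θ hQ hY hX => h'.throughput_le_reward hB hQ hY hX
  · rw [EReal.sub_le_iff_le_add (Or.inl (EReal.coe_ne_bot _)) (Or.inl (EReal.coe_ne_top _))]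
    refine sSup_le ?_
    rintro _ ⟨Ω', _, P', _, d', π', h', rfl⟩
    have := h.le_throughput hB fun θ hQ hY hX => h'.throughput_le_reward hB hQ hY hX
    rw [← EReal.coe_add, EReal.coe_le_coe_iff]
    linarith
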